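/- Let $n>1$. An almost quaternion-Hermitian manifold of dimension $4n$ is a Riemannian manifold $(M,g=\langle\cdot,\cdot\rangle)$ with a rank-three subbundle $\mathcal G\subset\mathrm{End}\,TM$ that locally has smooth adapted bases $I,J,K$, that is, $I^2=J^2=-1$, $K=IJ=-JI$, $\langle AX,AY\rangle=\langle X,Y\rangle$ for $A=I,J,K$. Let $\nabla$ be the Levi-Civita connection and $\widetilde\nabla=\nabla+\xi$ the minimal $\mathrm{Sp}(n)\mathrm{Sp}(1)$-connection, i.e. the metric connection preserving $\mathcal G$ for which every $\xi_X$ lies in the orthogonal complement of $\mathfrak{sp}(n)\oplus\mathfrak{sp}(1)$ (the skew endomorphisms normalising $\mathcal G$) in $\mathfrak{so}(T_pM)$. Let $R(X,Y,Z,U)=\langle R_{X,Y}Z,U\rangle$ with $R_{X,Y}=\nabla_{[X,Y]}-[\nabla_X,\nabla_Y]$. At a point, write $\omega_A(X,Y)=\langle X,AY\rangle$, let $\mathcal R\subset\Lambda^2\otimes\Lambda^2$ be the space of algebraic curvature tensors, and for $a\in\Lambda^2\otimes\Lambda^2$ put $$\pi_1(a)(X,Y,Z,U)=\tfrac14\Bigl(3a(X,Y,Z,U)-\sum_{A=I,J,K}a(X,Y,AZ,AU)\Bigr)-\tfrac1{4n}\sum_{A=I,J,K}\Bigl(\sum_{i,j}a(X,Y,e_i,e_j)\,\omega_A(e_i,e_j)\Bigr)\omega_A(Z,U),$$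 where $(e_i)$ is an orthonormal basis; $\pi_1$ is the projection to $\Lambda^2\otimes\Lambda^2_0E\,S^2H$. Let $\mathcal{QK}=\mathcal R\cap\ker\pi_1$ (the quaternionic K\"ahler curvature tensors), let $\mathcal{QK}^\perp$ be its orthogonal complement in $\mathcal R$ for the inner product $\langle a,b\rangle=\sum a(e_i,e_j,e_k,e_l)\,b(e_i,e_j,e_k,e_l)$, and let $\pi^\perp:\mathcal R\to\mathcal{QK}^\perp$ be the orthogonal projection. **Proposition.** The components of $\pi^\perp(R)$ in $\mathcal{QK}^\perp$ are linear functions of the components of $\widetilde\nabla\xi$ and $\xi\otimes\xi$. Precisely: for every $n>1$ there is a linear map $L$, depending only on $n$, such that for every almost quaternion-Hermitian manifold of dimension $4n$, every point $p$ and every adapted orthonormal frame $e$ of $T_pM$ (one of the form $v_a,Iv_a,Jv_a,Kv_a$, $a=1,\dots,n$, with $I,J,K$ an adapted basis of $\mathcal G_p$), the array of components of $\pi^\perp(R_p)$ in the frame $e$ is the value of $L$ on the pair consisting of the array of components $\langle(\widetilde\nabla_{e_i}\xi)_{e_j}e_k,e_l\rangle$ of $\widetilde\nabla\xi$ at $p$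 and the array of components $\langle\xi_{e_i}e_j,e_k\rangle\langle\xi_{e_r}e_s,e_t\rangle$ of $\xi\otimes\xi$ at $p$. -/

import Mathlib

open Bundle Manifold
open scoped ContDiff Topology

universe u

noncomputable section

/-! ### Algebra on the model space `ℝ^{4n} = ℍ^n`

The index `(a, 0), (a, 1), (a, 2), (a, 3)` stands for the vectors `v, I v, J v, K v` of an adapted
orthonormal frame, `a : Fin n`. Tensors are given by their components in such a frame. -/

/-- Index set of an adapted frame of a `4n`-dimensional space. -/
abbrev QIdx (n : ℕ) : Type := Fin n × Fin 4

/-- Components of tensors of type `(0,4)`; the inner product is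
`⟪a, b⟫ = ∑ i j k l, a i j k l * b i j k l`. -/
abbrev Tensor4 (n : ℕ) : Type := EuclideanSpace ℝ (QIdx n × QIdx n × QIdx n × QIdx n)

/-- Components of tensors of type `(0,6)`. -/
abbrev Tensor6 (n : ℕ) : Type :=
  EuclideanSpace ℝ (QIdx n × QIdx n × QIdx n × QIdx n × QIdx n × QIdx n)

/-- The matrices of `I`, `J`, `K` on `ℍ = span (v, I v, J v, K v)`, for `A = 0, 1, 2`. -/
def unitMatrix : Fin 3 → Matrix (Fin 4) (Fin 4) ℝ :=
  ![!![0, -1, 0, 0; 1, 0, 0, 0; 0, 0, 0, -1; 0, 0, 1, 0],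
    !![0, 0, -1, 0; 0, 0, 0, 1; 1, 0, 0, 0; 0, -1, 0, 0],
    !![0, 0, 0, -1; 0, 0, -1, 0; 0, 1, 0, 0; 1, 0, 0, 0]]

/-- The matrices of `I`, `J`, `K` in an adapted frame: `A e_k = ∑ i, quatMatrix n A i k • e_i`.
Hence also `ω_A(e_i, e_k) = ⟪e_i, A e_k⟫ = quatMatrix n A i k`. -/
def quatMatrix (n : ℕ) (A : Fin 3) : Matrix (QIdx n) (QIdx n) ℝ :=
  fun i k ↦ if i.1 = k.1 then unitMatrix A i.2 k.2 else 0

/-- The space `𝓡` of algebraic curvature tensors: the elements of `Sym² Λ²` satisfying the first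
Bianchi identity. -/
def curvatureTensors (n : ℕ) : Submodule ℝ (Tensor4 n) where
  carrier := {a | ∀ i j k l, a (i, j, k, l) = - a (j, i, k, l) ∧
    a (i, j, k, l) = - a (i, j, l, k) ∧ a (i, j, k, l) = a (k, l, i, j) ∧
    a (i, j, k, l) + a (j, k, i, l) + a (k, i, j, l) = 0}
  add_mem' {a b} ha hb i j k l := by
    obtain ⟨a1, a2, a3, a4⟩ := ha i j k l
    obtain ⟨b1, b2, b3, b4⟩ := hb i j k l
    simp only [PiLp.add_apply]
    exact ⟨by linarith, by linarith, by linarith, by linarith⟩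
  zero_mem' i j k l := by simp
  smul_mem' c a ha i j k l := by
    obtain ⟨a1, a2, a3, a4⟩ := ha i j k l
    simp only [PiLp.smul_apply, smul_eq_mul]
    exact ⟨by rw [a1]; ring, by rw [a2]; ring, by rw [a3],
      by rw [← mul_add, ← mul_add, a4, mul_zero]⟩

/-- `π_{1es}(a)(X, Y, Z, U) = ¼ (3 a(X, Y, Z, U) - ∑_A a(X, Y, A Z, A U))`,
the projection of the last two slots to `Λ²E S²H`. -/
def piOneES (n : ℕ) (a : Tensor4 n) (i j k l : QIdx n) : ℝ :=
  (1 / 4) * (3 * a (i, j, k, l) -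
    ∑ A, ∑ p, ∑ q, quatMatrix n A p k * quatMatrix n A q l * a (i, j, p, q))

/-- `π_{1s}(a)(X, Y, Z, U) = (1/4n) ∑_A (∑_{p,q} a(X, Y, e_p, e_q) ω_A(e_p, e_q)) ω_A(Z, U)`,
the projection of the last two slots to `S²H = span (ω_I, ω_J, ω_K)`. -/
def piOneS (n : ℕ) (a : Tensor4 n) (i j k l : QIdx n) : ℝ :=
  (1 / (4 * n)) * ∑ A, (∑ p, ∑ q, a (i, j, p, q) * quatMatrix n A p q) * quatMatrix n A k l

/-- `π_1 = π_{1es} - π_{1s}`, on `Λ² ⊗ Λ²` the projection to `Λ² ⊗ Λ₀²E S²H`. -/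
def piOne (n : ℕ) : Tensor4 n →ₗ[ℝ] Tensor4 n where
  toFun a := WithLp.toLp 2 fun s ↦
    piOneES n a s.1 s.2.1 s.2.2.1 s.2.2.2 - piOneS n a s.1 s.2.1 s.2.2.1 s.2.2.2
  map_add' a b := by
    ext s
    simp only [piOneES, piOneS, PiLp.add_apply, mul_add, add_mul, Finset.sum_add_distrib]
    ring
  map_smul' c a := by
    ext s
    simp only [piOneES, piOneS, PiLp.smul_apply, smul_eq_mul, RingHom.id_apply, mul_sub,
      Finset.mul_sum, Finset.sum_mul]
    congr 1
    · congr 1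
      · ring
      · exact Finset.sum_congr rfl fun A _ ↦ Finset.sum_congr rfl fun p _ ↦
          Finset.sum_congr rfl fun q _ ↦ by ring
    · exact Finset.sum_congr rfl fun A _ ↦ Finset.sum_congr rfl fun p _ ↦
        Finset.sum_congr rfl fun q _ ↦ by ring

/-- The space `𝒬𝒦 = 𝓡 ∩ ker π_1` of quaternionic Kähler curvature tensors. -/
def QK (n : ℕ) : Submodule ℝ (Tensor4 n) := curvatureTensors n ⊓ LinearMap.ker (piOne n)

/-- The orthogonal complement `𝒬𝒦^⊥` of `𝒬𝒦` in `𝓡`. -/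
def QKperp (n : ℕ) : Submodule ℝ (Tensor4 n) := curvatureTensors n ⊓ (QK n)ᗮ

/-- The orthogonal projection `π^⊥` to `𝒬𝒦^⊥`; it is only applied to elements of `𝓡`. -/
def piPerp (n : ℕ) (a : Tensor4 n) : QKperp n := (QKperp n).orthogonalProjectionOnto a

/-! ### Quaternionic structures on a Euclidean vector space -/

section Linear

variable {V : Type*} [NormedAddCommGroup V] [InnerProductSpace ℝ V]

/-- `I, J, K` is an adapted basis of the space `G` of endomorphisms of the Euclidean space `V`. -/
structure IsAdaptedBasis (G : Submodule ℝ (V →L[ℝ] V)) (I J K : V →L[ℝ] V) : Prop where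
  I_sq : ∀ x, I (I x) = - x
  J_sq : ∀ x, J (J x) = - x
  IJ : ∀ x, K x = I (J x)
  JI : ∀ x, K x = - J (I x)
  inner_I : ∀ x y, inner ℝ (I x) (I y) = inner ℝ x y
  inner_J : ∀ x y, inner ℝ (J x) (J y) = inner ℝ x y
  inner_K : ∀ x y, inner ℝ (K x) (K y) = inner ℝ x y
  span_eq : G = Submodule.span ℝ {I, J, K}

/-- The orthonormal frame `e` is adapted to `G`, i.e. it belongs to the `Sp(n)Sp(1)`-structure. -/
def IsAdaptedFrame {n : ℕ} (G : Submodule ℝ (V →L[ℝ] V)) (e : OrthonormalBasis (QIdx n) ℝ V) :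
    Prop :=
  ∃ I J K : V →L[ℝ] V, IsAdaptedBasis G I J K ∧
    ∀ a, e (a, 1) = I (e (a, 0)) ∧ e (a, 2) = J (e (a, 0)) ∧ e (a, 3) = K (e (a, 0))

/-- Membership of `B` in `𝔰𝔬(V)`. -/
def IsSkew (B : V →L[ℝ] V) : Prop := ∀ x y, inner ℝ (B x) y = - inner ℝ x (B y)

/-- Membership of `B` in `𝔰𝔭(n) ⊕ 𝔰𝔭(1)`, the Lie algebra of the group of the isometries of `V`
that preserve `G`. -/
def InStructureAlgebra (G : Submodule ℝ (V →L[ℝ] V)) (B : V →L[ℝ] V) : Prop :=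
  IsSkew B ∧ ∀ A ∈ G, B ∘L A - A ∘L B ∈ G

/-- Membership of `C` in the orthogonal complement of `𝔰𝔭(n) ⊕ 𝔰𝔭(1)` in `𝔰𝔬(V)`, for the
inner product `(B, C) ↦ - tr (B ∘ C)`. -/
def InStructureAlgebraPerp (G : Submodule ℝ (V →L[ℝ] V)) (C : V →L[ℝ] V) : Prop :=
  IsSkew C ∧ ∀ B, InStructureAlgebra G B → LinearMap.trace ℝ V (C ∘L B : V →L[ℝ] V).toLinearMap = 0

end Linear

/-! ### Almost quaternion-Hermitian manifolds -/

/-- The model space of `4n`-dimensional manifolds. -/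
abbrev Model (n : ℕ) : Type := EuclideanSpace ℝ (Fin (4 * n))

/-- The tangent space of a `4n`-dimensional manifold. -/
abbrev Tan (n : ℕ) {M : Type u} [TopologicalSpace M] [ChartedSpace (Model n) M] (p : M) : Type :=
  TangentSpace (𝓡 (4 * n)) p

/-- Affine connections. In Mathlib `D σ p x` is the derivative `(D_x σ)(p)`. -/
abbrev AffineConnection (n : ℕ) (M : Type u) [TopologicalSpace M] [ChartedSpace (Model n) M]
    [IsManifold (𝓡 (4 * n)) ∞ M] : Type u :=
  CovariantDerivative (𝓡 (4 * n)) (Model n) (fun p : M ↦ Tan n p)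

section Manifold

variable {n : ℕ} {M : Type u} [TopologicalSpace M] [ChartedSpace (Model n) M]
  [IsManifold (𝓡 (4 * n)) ∞ M]

/-- A field of endomorphisms of the tangent spaces is smooth on `U`. -/
def SmoothEndOn (A : ∀ p : M, Tan n p →L[ℝ] Tan n p) (U : Set M) : Prop :=
  ContMDiffOn (𝓡 (4 * n)) ((𝓡 (4 * n)).prod 𝓘(ℝ, Model n →L[ℝ] Model n)) ∞
    (fun p ↦ TotalSpace.mk' (Model n →L[ℝ] Model n)
      (E := fun p : M ↦ (Tan n p →L[ℝ] Tan n p)) p (A p)) U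

/-- `(D_x A) y = D_x (A Y) - A (D_x Y)` for a field `A` of endomorphisms; `Y` is an extension of `y`
to a vector field that is smooth near `p`. -/
def covDerivEnd (D : AffineConnection n M) (A : ∀ p : M, Tan n p →L[ℝ] Tan n p) (p : M)
    (x y : Tan n p) : Tan n p :=
  let Y : ∀ q : M, Tan n q := FiberBundle.extend (Model n) y
  D (fun q ↦ A q (Y q)) p x - A p (D Y p x)

/-- The curvature `R_{x,y} z = D_{[X,Y]} Z - D_X D_Y Z + D_Y D_X Z` at `p`; here `X`, `Y`, `Z` are
extensions of `x`, `y`, `z` to vector fields that are smooth near `p`. -/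
def curvature (D : AffineConnection n M) (p : M) (x y z : Tan n p) : Tan n p :=
  let X : ∀ q : M, Tan n q := FiberBundle.extend (Model n) x
  let Y : ∀ q : M, Tan n q := FiberBundle.extend (Model n) y
  let Z : ∀ q : M, Tan n q := FiberBundle.extend (Model n) z
  D Z p (VectorField.mlieBracket (𝓡 (4 * n)) X Y p)
    - D (fun q ↦ D Z q (Y q)) p x + D (fun q ↦ D Z q (X q)) p y

/-- `ξ_x = D'_x - D_x`, as an endomorphism of the tangent space. -/
def diffTensor (D D' : AffineConnection n M) (p : M) (x : Tan n p) : Tan n p →L[ℝ] Tan n p where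
  toFun z := CovariantDerivative.difference D' D p z x
  map_add' z w := by simp
  map_smul' c z := by simp
  cont := by fun_prop

/-- `(D'_x ξ)_y z = D'_x (ξ_Y Z) - ξ_{D'_x Y} z - ξ_y (D'_x Z)` at `p`, for `ξ = D' - D`; here `Y`,
`Z` are extensions of `y`, `z` to vector fields that are smooth near `p`. -/
def covDerivDiffTensor (D D' : AffineConnection n M) (p : M) (x y z : Tan n p) : Tan n p :=
  let Y : ∀ q : M, Tan n q := FiberBundle.extend (Model n) y
  let Z : ∀ q : M, Tan n q := FiberBundle.extend (Model n) z
  D' (fun q ↦ diffTensor D D' q (Y q) (Z q)) p x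
    - diffTensor D D' p (D' Y p x) z - diffTensor D D' p y (D' Z p x)

variable [RiemannianBundle (fun p : M ↦ Tan n p)]

/-- `I, J, K` is a smooth adapted basis of `G` on the open set `U`. -/
structure IsLocalAdaptedBasis (G : ∀ p : M, Submodule ℝ (Tan n p →L[ℝ] Tan n p)) (U : Set M)
    (I J K : ∀ p : M, Tan n p →L[ℝ] Tan n p) : Prop where
  isOpen : IsOpen U
  smooth_I : SmoothEndOn I U
  smooth_J : SmoothEndOn J U
  smooth_K : SmoothEndOn K U
  adapted : ∀ p ∈ U, IsAdaptedBasis (G p) (I p) (J p) (K p)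

variable (n M) in
/-- An almost quaternion-Hermitian structure on a Riemannian manifold: a rank-three subbundle of the
bundle of endomorphisms of the tangent bundle that has local adapted bases. -/
structure AlmostQuaternionHermitian where
  /-- The fibres of the subbundle. -/
  G : ∀ p : M, Submodule ℝ (Tan n p →L[ℝ] Tan n p)
  exists_adapted : ∀ p : M, ∃ U : Set M, p ∈ U ∧ ∃ I J K, IsLocalAdaptedBasis G U I J K

/-- Components of the curvature in a frame: `R(e_i, e_j, e_k, e_l) = ⟪R_{e_i,e_j} e_k, e_l⟫`. -/
def curvatureComp (D : AffineConnection n M) {p : M} (e : OrthonormalBasis (QIdx n) ℝ (Tan n p)) :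
    Tensor4 n :=
  WithLp.toLp 2 fun (i, j, k, l) ↦ inner ℝ (curvature D p (e i) (e j) (e k)) (e l)

/-- Components `⟪(D'_{e_i} ξ)_{e_j} e_k, e_l⟫` of `D' ξ`, where `ξ = D' - D`. -/
def covDerivDiffComp (D D' : AffineConnection n M) {p : M}
    (e : OrthonormalBasis (QIdx n) ℝ (Tan n p)) : Tensor4 n :=
  WithLp.toLp 2 fun (i, j, k, l) ↦ inner ℝ (covDerivDiffTensor D D' p (e i) (e j) (e k)) (e l)

/-- Components `⟪ξ_{e_i} e_j, e_k⟫ ⟪ξ_{e_r} e_s, e_t⟫` of `ξ ⊗ ξ`, where `ξ = D' - D`. -/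
def diffTensorSqComp (D D' : AffineConnection n M) {p : M}
    (e : OrthonormalBasis (QIdx n) ℝ (Tan n p)) : Tensor6 n :=
  WithLp.toLp 2 fun (i, j, k, r, s, t) ↦
    inner ℝ (diffTensor D D' p (e i) (e j)) (e k) * inner ℝ (diffTensor D D' p (e r) (e s)) (e t)

variable [IsContMDiffRiemannianBundle (𝓡 (4 * n)) ∞ (Model n) (fun p : M ↦ Tan n p)]

instance instRiemannianTanOne :
    IsContMDiffRiemannianBundle (𝓡 (4 * n)) 1 (Model n) (fun p : M ↦ Tan n p) :=
  IsContMDiffRiemannianBundle.of_le (n := ∞) (by simp)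

/-- `D` is the Levi-Civita connection. -/
structure IsLeviCivita (D : AffineConnection n M) : Prop where
  smooth : CovariantDerivative.ContMDiffCovariantDerivative D ∞
  metric : D.IsMetricCompatible
  torsion_eq_zero : D.torsion = 0

/-- `D` is an `Sp(n)Sp(1)`-connection: it is metric, and it preserves the subbundle `G`. -/
structure IsSpnSp1Connection (Q : AlmostQuaternionHermitian n M) (D : AffineConnection n M) :
    Prop where
  smooth : CovariantDerivative.ContMDiffCovariantDerivative D ∞
  metric : D.IsMetricCompatible
  preserves : ∀ p : M, ∃ U : Set M, p ∈ U ∧ ∃ I J K, IsLocalAdaptedBasis Q.G U I J K ∧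
    ∃ lI lJ lK : ∀ q : M, Tan n q →L[ℝ] ℝ, ∀ q ∈ U, ∀ x y : Tan n q,
      covDerivEnd D I q x y = lK q x • J q y - lJ q x • K q y ∧
      covDerivEnd D J q x y = lI q x • K q y - lK q x • I q y ∧
      covDerivEnd D K q x y = lJ q x • I q y - lI q x • J q y

/-- `D'` is the minimal `Sp(n)Sp(1)`-connection, `D` being the Levi-Civita connection: the
`Sp(n)Sp(1)`-connection such that `ξ = D' - D` takes values in the orthogonal complement of
`𝔰𝔭(n) ⊕ 𝔰𝔭(1)`. -/
structure IsMinimalConnection (Q : AlmostQuaternionHermitian n M) (D D' : AffineConnection n M) :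
    Prop extends IsSpnSp1Connection Q D' where
  perp : ∀ (p : M) (x : Tan n p), InStructureAlgebraPerp (Q.G p) (diffTensor D D' p x)

end Manifold

end

/-!
Write `R` and `R'` for the curvatures of the Levi-Civita connection `D` and of the minimal
connection `D' = D + ξ`. The component `π^⊥(R)` is determined by `π₁(R)`, because `π₁` is injective
on `𝒬𝒦^⊥` and vanishes on `𝒬𝒦` (`exists_piPerp_eq_comp_piOne`; this uses that `R` is an algebraic
curvature tensor, `curvatureComp_mem_curvatureTensors`). Since `D` is torsion-free,
`R_{X,Y} = R'_{X,Y} + (D'_X ξ)_Y - (D'_Y ξ)_X + ξ_{ξ_X Y - ξ_Y X} - [ξ_X, ξ_Y]`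
(`curvature_eq_add`), so that `R - R'` has components linear in those of `D' ξ` and `ξ ⊗ ξ`.
Finally `π₁(R') = 0` (`piOne_curvatureComp_eq_zero`): as `D'` preserves the bundle `G`, its curvature
operators normalise `G`, i.e. they lie in `𝔰𝔭(n) ⊕ 𝔰𝔭(1)`, where `π₁` vanishes. Hence
`π^⊥(R) = ρ (π₁ (R - R'))` with `ρ` a left inverse of `π₁` on `𝒬𝒦^⊥`.

Two devices replace computations in coordinates. The identity `[X, Y] f = X (Y f) - Y (X f)` is read
off from the Jacobi identity for `X`, `Y`, `f Z` (`dirDeriv_mlieBracket`). And tensoriality in the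
differentiated argument, for the curvature and for the covariant derivative of an endomorphism
field, follows from skewness: if `⟪T Z, W⟫ = - ⟪Z, T W⟫` for all smooth fields, then `T Z` at `p`
depends only on `Z p` (`fieldCurvature_congr`, `covDerivEnd_eq`).
-/

noncomputable section

/-! ### Reduction to the projection `π₁` -/

lemma curvatureTensors_sub_mem_QKperp {n : ℕ} {a : Tensor4 n} (ha : a ∈ curvatureTensors n) :
    a - (QK n).starProjection a ∈ QKperp n :=
  ⟨sub_mem ha ((QK n).starProjection_apply_mem a).1, (QK n).sub_starProjection_mem_orthogonal a⟩

/-- On `𝓡`, the projection `π^⊥` removes the `𝒬𝒦` component. -/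
lemma coe_piPerp {n : ℕ} {a : Tensor4 n} (ha : a ∈ curvatureTensors n) :
    (piPerp n a : Tensor4 n) = a - (QK n).starProjection a := by
  refine Submodule.eq_starProjection_of_mem_of_inner_eq_zero (K := QKperp n)
    (curvatureTensors_sub_mem_QKperp ha) fun w hw ↦ ?_
  rw [sub_sub_cancel]
  exact hw.2 _ ((QK n).starProjection_apply_mem a)

/-- Since `π₁` is injective on `𝒬𝒦^⊥` and vanishes on `𝒬𝒦`, the component of a curvature tensor in
`𝒬𝒦^⊥` is a linear function of its image under `π₁`. -/
lemma exists_piPerp_eq_comp_piOne (n : ℕ) :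
    ∃ ρ : Tensor4 n →ₗ[ℝ] QKperp n, ∀ a ∈ curvatureTensors n, piPerp n a = ρ (piOne n a) := by
  obtain ⟨ρ, hρ⟩ := ((piOne n).domRestrict (QKperp n)).exists_leftInverse_of_injective <| by
    rw [LinearMap.ker_eq_bot']
    rintro ⟨x, hx⟩ h
    have hQ : x ∈ QK n := ⟨hx.1, h⟩
    simpa using Submodule.inner_right_of_mem_orthogonal hQ hx.2
  refine ⟨ρ, fun a ha ↦ ?_⟩
  have h : piOne n a = (piOne n).domRestrict (QKperp n) (piPerp n a) := by
    have h0 : piOne n ((QK n).starProjection a) = 0 := ((QK n).starProjection_apply_mem a).2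
    rw [LinearMap.domRestrict_apply, coe_piPerp ha, map_sub, h0, sub_zero]
  rw [h]
  exact (LinearMap.congr_fun hρ _).symm

/-! ### Matrices normalising the quaternionic structure -/

section Matrices

open scoped Kronecker Matrix

lemma quatMatrix_eq_kronecker (n : ℕ) (A : Fin 3) :
    quatMatrix n A = (1 : Matrix (Fin n) (Fin n) ℝ) ⊗ₖ unitMatrix A := by
  ext i k
  simp [quatMatrix, Matrix.kroneckerMap_apply, Matrix.one_apply]

lemma quatMatrix_transpose (n : ℕ) (A : Fin 3) : (quatMatrix n A)ᵀ = - quatMatrix n A := by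
  ext i k
  have h : unitMatrix A k.2 i.2 = - unitMatrix A i.2 k.2 := by
    generalize k.2 = s
    generalize i.2 = t
    fin_cases A <;> fin_cases s <;> fin_cases t <;> simp [unitMatrix]
  simp only [Matrix.transpose_apply, Matrix.neg_apply, quatMatrix, eq_comm (a := k.1), h]
  split_ifs <;> simp

lemma quatMatrix_mul_self (n : ℕ) (A : Fin 3) : quatMatrix n A * quatMatrix n A = -1 := by
  have h : unitMatrix A * unitMatrix A = -1 := by
    ext s t
    fin_cases A <;> fin_cases s <;> fin_cases t <;>
      simp [unitMatrix, Matrix.mul_apply, Fin.sum_univ_four]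
  rw [quatMatrix_eq_kronecker, ← Matrix.mul_kronecker_mul, h, one_mul, ← neg_one_smul ℝ,
    Matrix.kronecker_smul, Matrix.one_kronecker_one, neg_one_smul]

/-- The relations `I J = K`, `J K = I`, `K I = J`; the addition in `Fin 3` is modulo `3`. -/
lemma quatMatrix_mul_add_one (n : ℕ) (A : Fin 3) :
    quatMatrix n A * quatMatrix n (A + 1) = quatMatrix n (A + 2) := by
  have h : unitMatrix A * unitMatrix (A + 1) = unitMatrix (A + 2) := by
    ext s t
    fin_cases A <;> fin_cases s <;> fin_cases t <;>
      simp [unitMatrix, Matrix.mul_apply, Fin.sum_univ_four]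
  simp only [quatMatrix_eq_kronecker, ← Matrix.mul_kronecker_mul, h, one_mul]

/-- The matrices `I`, `J`, `K` are orthogonal, of norm `√(4n)`. -/
lemma trace_quatMatrix_transpose_mul (n : ℕ) (A C : Fin 3) :
    ((quatMatrix n A)ᵀ * quatMatrix n C).trace = if A = C then 4 * n else 0 := by
  have h : ((unitMatrix A)ᵀ * unitMatrix C).trace = if A = C then 4 else 0 := by
    rw [Matrix.trace, Fin.sum_univ_four]
    simp only [Matrix.diag_apply, Matrix.mul_apply, Fin.sum_univ_four, Matrix.transpose_apply]
    fin_cases A <;> fin_cases C <;> simp [unitMatrix] <;> norm_num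
  have hk : ((1 : Matrix (Fin n) (Fin n) ℝ) ⊗ₖ unitMatrix A)ᵀ = 1 ⊗ₖ (unitMatrix A)ᵀ := by
    rw [← Matrix.kroneckerMap_transpose, Matrix.transpose_one]
  rw [quatMatrix_eq_kronecker, quatMatrix_eq_kronecker, hk, ← Matrix.mul_kronecker_mul,
    Matrix.trace_kronecker, h, one_mul, Matrix.trace_one, Fintype.card_fin]
  split_ifs <;> simp [mul_comm]

lemma quatMatrix_add_one_mul (n : ℕ) (A : Fin 3) :
    quatMatrix n (A + 1) * quatMatrix n A = - quatMatrix n (A + 2) := by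
  simpa [quatMatrix_transpose] using congr_arg Matrix.transpose (quatMatrix_mul_add_one n A)

lemma quatMatrix_mul_add_two (n : ℕ) (A : Fin 3) :
    quatMatrix n A * quatMatrix n (A + 2) = - quatMatrix n (A + 1) := by
  rw [← quatMatrix_mul_add_one, ← mul_assoc, quatMatrix_mul_self, neg_one_mul]

lemma quatMatrix_add_two_mul (n : ℕ) (A : Fin 3) :
    quatMatrix n (A + 2) * quatMatrix n A = quatMatrix n (A + 1) := by
  simpa [quatMatrix_transpose] using congr_arg Matrix.transpose (quatMatrix_mul_add_two n A)

/-- The addition in `Fin 3` is modulo `3`, so `A`, `A + 1`, `A + 2` run through all of them. -/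
lemma sum_fin_three_cyclic {E : Type*} [AddCommMonoid E] (f : Fin 3 → E) (A : Fin 3) :
    ∑ C, f C = f A + f (A + 1) + f (A + 2) := by
  rw [← Equiv.sum_comp (Equiv.addLeft A) f, Fin.sum_univ_three]
  simp

/-- If `[B, A]` lies in the span of `I`, `J`, `K`, then it has no `A`-component, since it
anticommutes with `A`; hence `A [B, A]` lies in that span as well. -/
lemma quatMatrix_mul_commutator_mem_span {n : ℕ} {B : Matrix (QIdx n) (QIdx n) ℝ} {A : Fin 3}
    (h : B * quatMatrix n A - quatMatrix n A * B ∈ Submodule.span ℝ (Set.range (quatMatrix n))) :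
    quatMatrix n A * (B * quatMatrix n A - quatMatrix n A * B) ∈
      Submodule.span ℝ (Set.range (quatMatrix n)) := by
  obtain ⟨c, hc⟩ := (Submodule.mem_span_range_iff_exists_fun ℝ).1 h
  rw [sum_fin_three_cyclic _ A] at hc
  have h1 : quatMatrix n A * (B * quatMatrix n A - quatMatrix n A * B)
      + (B * quatMatrix n A - quatMatrix n A * B) * quatMatrix n A = 0 := by
    have h2 := quatMatrix_mul_self n A
    calc _ = B * (quatMatrix n A * quatMatrix n A) - (quatMatrix n A * quatMatrix n A) * B := by
          noncomm_ring
      _ = 0 := by rw [h2]; noncomm_ring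
  rw [← hc] at h1 ⊢
  simp only [mul_add, add_mul, mul_smul_comm, smul_mul_assoc, quatMatrix_mul_self,
    quatMatrix_mul_add_one, quatMatrix_mul_add_two, quatMatrix_add_one_mul,
    quatMatrix_add_two_mul] at h1 ⊢
  have h0 : c A • (-1 : Matrix (QIdx n) (QIdx n) ℝ) = 0 := by
    have : (2 : ℝ) • (c A • (-1 : Matrix (QIdx n) (QIdx n) ℝ)) = 0 := by
      rw [← h1]; module
    simpa using this
  rw [h0, zero_add]
  exact add_mem (Submodule.smul_mem _ _ (Submodule.subset_span ⟨_, rfl⟩))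
    (Submodule.smul_mem _ _ (neg_mem (Submodule.subset_span ⟨_, rfl⟩)))

/-- The part `¼ (3 B + ∑_A A B A)` of a matrix `B` normalising the quaternionic structure lies in
`𝔰𝔭(1) = span (I, J, K)`, for it is the sum of the `¼ A [B, A]`. -/
lemma three_smul_add_sum_mem_span {n : ℕ} {B : Matrix (QIdx n) (QIdx n) ℝ}
    (h : ∀ A, B * quatMatrix n A - quatMatrix n A * B ∈
      Submodule.span ℝ (Set.range (quatMatrix n))) :
    (1 / 4 : ℝ) • ((3 : ℝ) • B + ∑ A, quatMatrix n A * B * quatMatrix n A) ∈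
      Submodule.span ℝ (Set.range (quatMatrix n)) := by
  refine Submodule.smul_mem _ _ ?_
  have h1 : (3 : ℝ) • B + ∑ A, quatMatrix n A * B * quatMatrix n A =
      ∑ A, quatMatrix n A * (B * quatMatrix n A - quatMatrix n A * B) := by
    simp only [mul_sub, ← mul_assoc, quatMatrix_mul_self, neg_one_mul, sub_neg_eq_add,
      Finset.sum_add_distrib, Finset.sum_const, Finset.card_univ, Fintype.card_fin]
    rw [add_comm, ofNat_smul_eq_nsmul]
  rw [h1]
  exact sum_mem fun A _ ↦ quatMatrix_mul_commutator_mem_span (h A)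

/-- The projection `B ↦ ¼ (3 B + ∑_A A B A)` preserves the inner products with `I`, `J`, `K`. -/
lemma trace_quatMatrix_mul_three_smul_add_sum (n : ℕ) (B : Matrix (QIdx n) (QIdx n) ℝ)
    (C : Fin 3) :
    (quatMatrix n C * ((1 / 4 : ℝ) • ((3 : ℝ) • B + ∑ A, quatMatrix n A * B * quatMatrix n A))).trace
      = (quatMatrix n C * B).trace := by
  have h1 (A : Fin 3) : (quatMatrix n C * (quatMatrix n A * B * quatMatrix n A)).trace =
      (quatMatrix n A * quatMatrix n C * quatMatrix n A * B).trace := by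
    rw [← mul_assoc, Matrix.trace_mul_comm, ← mul_assoc, ← mul_assoc]
  rw [mul_smul_comm, mul_add, mul_smul_comm, Finset.mul_sum, Matrix.trace_smul, Matrix.trace_add,
    Matrix.trace_smul, Matrix.trace_sum, sum_fin_three_cyclic _ C]
  simp only [h1]
  rw [quatMatrix_mul_self, quatMatrix_add_one_mul, quatMatrix_add_two_mul, neg_mul,
    neg_mul, neg_mul, one_mul]
  have e1 : quatMatrix n (C + 2) * quatMatrix n (C + 1) = - quatMatrix n C := by
    have := quatMatrix_add_one_mul n (C + 1)
    rwa [add_assoc, add_assoc, show (1 + 1 : Fin 3) = 2 from rfl, show (1 + 2 : Fin 3) = 0 from rfl,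
      add_zero] at this
  have e2 : quatMatrix n (C + 1) * quatMatrix n (C + 2) = quatMatrix n C := by
    have := quatMatrix_mul_add_one n (C + 1)
    rwa [add_assoc, add_assoc, show (1 + 1 : Fin 3) = 2 from rfl, show (1 + 2 : Fin 3) = 0 from rfl,
      add_zero] at this
  rw [e1, e2]
  simp
  ring

/-- `π₁` vanishes on the matrices that normalise the quaternionic structure: their part in
`Λ²E S²H`, on the left, is their `𝔰𝔭(1)`-component, on the right. -/
lemma three_smul_add_sum_eq_sum_trace {n : ℕ} (hn : n ≠ 0) {B : Matrix (QIdx n) (QIdx n) ℝ}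
    (h : ∀ A, B * quatMatrix n A - quatMatrix n A * B ∈
      Submodule.span ℝ (Set.range (quatMatrix n))) :
    (1 / 4 : ℝ) • ((3 : ℝ) • B + ∑ A, quatMatrix n A * B * quatMatrix n A) =
      (1 / (4 * n) : ℝ) • ∑ A, ((quatMatrix n A)ᵀ * B).trace • quatMatrix n A := by
  obtain ⟨u, hu⟩ :=
    (Submodule.mem_span_range_iff_exists_fun ℝ).1 (three_smul_add_sum_mem_span h)
  have h1 (A : Fin 3) : ((quatMatrix n A)ᵀ * B).trace = 4 * n * u A := by
    rw [quatMatrix_transpose, neg_mul, Matrix.trace_neg,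
      ← trace_quatMatrix_mul_three_smul_add_sum, ← hu, ← Matrix.trace_neg, ← neg_mul,
      ← quatMatrix_transpose, Finset.mul_sum, Matrix.trace_sum]
    simp [trace_quatMatrix_transpose_mul, mul_comm]
  have hn' : (n : ℝ) ≠ 0 := by exact_mod_cast hn
  rw [← hu, Finset.smul_sum]
  refine Finset.sum_congr rfl fun A _ ↦ ?_
  rw [h1, smul_smul]
  congr 1
  field_simp

/-- `π₁` vanishes on the tensors whose last two slots normalise the quaternionic structure. -/
lemma piOne_eq_zero {n : ℕ} (hn : n ≠ 0) {a : Tensor4 n}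
    (h : ∀ i j A, Matrix.of (fun p q ↦ a (i, j, p, q)) * quatMatrix n A
      - quatMatrix n A * Matrix.of (fun p q ↦ a (i, j, p, q)) ∈
        Submodule.span ℝ (Set.range (quatMatrix n))) :
    piOne n a = 0 := by
  ext ⟨i, j, k, l⟩
  have h1 := congr_fun (congr_fun (three_smul_add_sum_eq_sum_trace hn (h i j)) k) l
  have h2 (A : Fin 3) (p k : QIdx n) : quatMatrix n A p k = - quatMatrix n A k p := by
    rw [← Matrix.neg_apply, ← quatMatrix_transpose, Matrix.transpose_apply]
  have h3 : piOneES n a i j k l = piOneS n a i j k l := by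
    simp only [Matrix.smul_apply, Matrix.add_apply, Matrix.of_apply, Matrix.sum_apply,
      smul_eq_mul] at h1
    rw [piOneES, piOneS]
    convert h1 using 2
    · rw [sub_eq_add_neg, ← Finset.sum_neg_distrib]
      congr 1
      refine Finset.sum_congr rfl fun A _ ↦ ?_
      rw [Matrix.mul_apply, Finset.sum_comm, ← Finset.sum_neg_distrib]
      refine Finset.sum_congr rfl fun q _ ↦ ?_
      rw [Matrix.mul_apply, Finset.sum_mul, ← Finset.sum_neg_distrib]
      refine Finset.sum_congr rfl fun p _ ↦ ?_
      rw [h2 A p k, Matrix.of_apply]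
      ring
    · refine Finset.sum_congr rfl fun A _ ↦ ?_
      congr 1
      rw [Matrix.trace, Finset.sum_comm]
      refine Finset.sum_congr rfl fun q _ ↦ ?_
      rw [Matrix.diag_apply, Matrix.mul_apply]
      refine Finset.sum_congr rfl fun p _ ↦ ?_
      rw [Matrix.transpose_apply, Matrix.of_apply, mul_comm]
  simp [piOne, h3]

end Matrices

/-! ### Endomorphisms in an adapted frame -/

section Frame

variable {V : Type*} [NormedAddCommGroup V] [InnerProductSpace ℝ V]

/-- The matrix `(⟪B e_p, e_q⟫)_{p,q}` of an endomorphism `B` in an orthonormal frame; it is the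
transpose of the usual one, so that composition is reversed. -/
def frameMatrix {ι : Type*} [Fintype ι] (e : OrthonormalBasis ι ℝ V) :
    (V →ₗ[ℝ] V) →ₗ[ℝ] Matrix ι ι ℝ where
  toFun B := Matrix.of fun p q ↦ inner ℝ (B (e p)) (e q)
  map_add' B C := by ext; simp [inner_add_left]
  map_smul' c B := by ext; simp [inner_smul_left]

lemma frameMatrix_comp {ι : Type*} [Fintype ι] (e : OrthonormalBasis ι ℝ V) (B C : V →ₗ[ℝ] V) :
    frameMatrix e (B ∘ₗ C) = frameMatrix e C * frameMatrix e B := by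
  ext p q
  simp only [frameMatrix, LinearMap.coe_mk, AddHom.coe_mk, Matrix.of_apply, Matrix.mul_apply,
    LinearMap.comp_apply]
  conv_lhs => rw [← e.sum_repr' (C (e p))]
  simp only [map_sum, map_smul, sum_inner, inner_smul_left, RCLike.conj_to_real,
    real_inner_comm]

/-- In an adapted frame, the members `I`, `J`, `K` of an adapted basis have the standard
matrices. -/
lemma frameMatrix_of_isAdaptedBasis {n : ℕ} {G : Submodule ℝ (V →L[ℝ] V)}
    {e : OrthonormalBasis (QIdx n) ℝ V} {I J K : V →L[ℝ] V} (h : IsAdaptedBasis G I J K)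
    (he : ∀ a, e (a, 1) = I (e (a, 0)) ∧ e (a, 2) = J (e (a, 0)) ∧ e (a, 3) = K (e (a, 0)))
    (A : Fin 3) :
    frameMatrix e ((![I, J, K] A : V →L[ℝ] V) : V →ₗ[ℝ] V) = - quatMatrix n A := by
  have hKI (x : V) : I (K x) = - J x := by rw [h.IJ, h.I_sq]
  have hJI (x : V) : J (I x) = - K x := by rw [h.JI, neg_neg]
  have hJK (x : V) : J (K x) = I x := by
    rw [h.IJ, ← neg_neg (J (I (J x))), ← h.JI, h.IJ, h.J_sq]; simp
  have hKx (x : V) : K (I x) = J x := by rw [h.JI, h.I_sq]; simp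
  have hKJ (x : V) : K (J x) = - I x := by rw [h.IJ, h.J_sq]; simp
  have hKK (x : V) : K (K x) = - x := by rw [h.JI, hKI, map_neg, h.J_sq, neg_neg]
  have key (a : Fin n) (s : Fin 4) :
      (![I, J, K] A : V →L[ℝ] V) (e (a, s)) = ∑ t, unitMatrix A t s • e (a, t) := by
    obtain ⟨e1, e2, e3⟩ := he a
    rw [Fin.sum_univ_four, e1, e2, e3]
    fin_cases A <;> fin_cases s <;>
      simp [unitMatrix, e1, e2, e3, h.I_sq, h.J_sq, ← h.IJ, hKI, hJI, hJK, hKx, hKJ, hKK]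
  ext ⟨a, s⟩ ⟨b, t⟩
  have hq : -quatMatrix n A (a, s) (b, t) = quatMatrix n A (b, t) (a, s) := by
    rw [← Matrix.neg_apply, ← quatMatrix_transpose, Matrix.transpose_apply]
  rw [Matrix.neg_apply, hq]
  simp only [frameMatrix, LinearMap.coe_mk, AddHom.coe_mk, Matrix.of_apply,
    ContinuousLinearMap.coe_coe, key, sum_inner, inner_smul_left, e.inner_eq_ite,
    quatMatrix, Prod.mk.injEq, RCLike.conj_to_real]
  by_cases hab : a = b
  · simp [hab]
  · simp [hab, Ne.symm hab]

/-- If `B` normalises `G`, its matrix in an adapted frame normalises the quaternionic structure of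
the model space. -/
lemma frameMatrix_commutator_mem_span {n : ℕ} {G : Submodule ℝ (V →L[ℝ] V)}
    {e : OrthonormalBasis (QIdx n) ℝ V} (he : IsAdaptedFrame G e) {B : V →ₗ[ℝ] V}
    (hB : ∀ A ∈ G, ∃ C ∈ G, ∀ z, B (A z) - A (B z) = C z) (A : Fin 3) :
    frameMatrix e B * quatMatrix n A - quatMatrix n A * frameMatrix e B ∈
      Submodule.span ℝ (Set.range (quatMatrix n)) := by
  obtain ⟨I, J, K, h, he⟩ := he
  have hG : G = Submodule.span ℝ (Set.range ![I, J, K]) := by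
    rw [h.span_eq, Matrix.range_cons, Matrix.range_cons, Matrix.range_cons, Matrix.range_empty]
    simp only [Set.union_empty, ← Set.insert_eq]
  obtain ⟨C, hC, hBC⟩ := hB (![I, J, K] A) (hG ▸ Submodule.subset_span ⟨A, rfl⟩)
  have h1 : B ∘ₗ (![I, J, K] A : V →L[ℝ] V).toLinearMap
      - (![I, J, K] A : V →L[ℝ] V).toLinearMap ∘ₗ B = C.toLinearMap := LinearMap.ext hBC
  have h2 := congr_arg (frameMatrix e) h1
  rw [map_sub, frameMatrix_comp, frameMatrix_comp, frameMatrix_of_isAdaptedBasis h he] at h2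
  have h3 : frameMatrix e B * quatMatrix n A - quatMatrix n A * frameMatrix e B =
      frameMatrix e C.toLinearMap := by
    rw [← h2]; noncomm_ring
  rw [h3]
  obtain ⟨c, rfl⟩ := (Submodule.mem_span_range_iff_exists_fun ℝ).1 (hG ▸ hC)
  have h4 : (∑ i, c i • (![I, J, K] i : V →L[ℝ] V)).toLinearMap =
      ∑ i, c i • (![I, J, K] i : V →L[ℝ] V).toLinearMap := by
    ext; simp
  rw [h4, map_sum]
  refine sum_mem fun i _ ↦ ?_
  rw [map_smul, frameMatrix_of_isAdaptedBasis h he]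
  exact Submodule.smul_mem _ _ (neg_mem (Submodule.subset_span ⟨_, rfl⟩))

end Frame

/-! ### Vector fields smooth near a point -/

section Fields

variable {n : ℕ} {M : Type u} [TopologicalSpace M] [ChartedSpace (Model n) M]
  [IsManifold (𝓡 (4 * n)) ∞ M]

/-- The vector field `X` is smooth at `p`. -/
abbrev SmoothFieldAt (X : ∀ q : M, Tan n q) (p : M) : Prop :=
  ContMDiffAt (𝓡 (4 * n)) ((𝓡 (4 * n)).prod 𝓘(ℝ, Model n)) ∞
    (fun q ↦ TotalSpace.mk' (Model n) (E := fun q : M ↦ Tan n q) q (X q)) p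

/-- The vector field `X` is differentiable at `p`. -/
abbrev DiffFieldAt (X : ∀ q : M, Tan n q) (p : M) : Prop :=
  MDifferentiableAt (𝓡 (4 * n)) ((𝓡 (4 * n)).prod 𝓘(ℝ, Model n))
    (fun q ↦ TotalSpace.mk' (Model n) (E := fun q : M ↦ Tan n q) q (X q)) p

/-- The vector field `X` is smooth at all points near `p`. (Being `ContMDiffAt` of class `C^∞` at
`p` is weaker: it gives for each finite `k` a neighbourhood on which `X` is `C^k`.) -/
def SmoothNear (X : ∀ q : M, Tan n q) (p : M) : Prop :=
  ∀ᶠ q in 𝓝 p, SmoothFieldAt X q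

/-- The derivative of the function `f` at `p` in the direction `x`. -/
abbrev dirDeriv (f : M → ℝ) (p : M) (x : Tan n p) : ℝ := mvfderiv (𝓡 (4 * n)) f p x

/-- The function `f` is differentiable at `p`. -/
abbrev DiffFunAt (n : ℕ) {M : Type u} [TopologicalSpace M] [ChartedSpace (Model n) M]
    (f : M → ℝ) (p : M) : Prop := MDifferentiableAt (𝓡 (4 * n)) 𝓘(ℝ, ℝ) f p

lemma SmoothNear.eventually {X : ∀ q : M, Tan n q} {p : M} (h : SmoothNear X p) :
    ∀ᶠ q in 𝓝 p, SmoothNear X q := eventually_eventually_nhds.2 h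

lemma SmoothNear.diffFieldAt {X : ∀ q : M, Tan n q} {p : M} (h : SmoothNear X p) :
    DiffFieldAt X p := h.self_of_nhds.mdifferentiableAt (by simp)

lemma smoothNear_extend {p : M} (x : Tan n p) :
    SmoothNear (FiberBundle.extend (Model n) x) p := by
  obtain ⟨s, hs, h⟩ := FiberBundle.exists_contMDiffOn_extend (k := ∞) (𝓡 (4 * n)) (Model n)
    (V := fun q : M ↦ Tan n q) x
  filter_upwards [eventually_mem_nhds_iff.2 hs] with q hq
  exact h.contMDiffAt hq

lemma isManifold_minSmoothness (k : ℕ) : IsManifold (𝓡 (4 * n)) (minSmoothness ℝ k) M := by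
  rw [minSmoothness_of_isRCLikeNormedField]
  infer_instance

lemma SmoothNear.mlieBracket {X Y : ∀ q : M, Tan n q} {p : M} (hX : SmoothNear X p)
    (hY : SmoothNear Y p) : SmoothNear (VectorField.mlieBracket (𝓡 (4 * n)) X Y) p := by
  have : IsManifold (𝓡 (4 * n)) (minSmoothness ℝ 2) M := isManifold_minSmoothness 2
  filter_upwards [hX, hY] with q hXq hYq
  have : IsManifold (𝓡 (4 * n)) (((⊤ : ℕ∞) : WithTop ℕ∞) + 1) M :=
    (inferInstance : IsManifold (𝓡 (4 * n)) ∞ M)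
  exact ContMDiffAt.mlieBracket_vectorField (n := ⊤) (m := ⊤) hXq hYq (by simp)

/-- Every vector field that is smooth near a point agrees near it with a globally smooth one. -/
lemma SmoothNear.exists_contMDiff [T2Space M] {X : ∀ q : M, Tan n q} {p : M} (h : SmoothNear X p) :
    ∃ X' : ∀ q : M, Tan n q, (∀ q, SmoothFieldAt X' q) ∧ ∀ᶠ q in 𝓝 p, X' q = X q := by
  obtain ⟨U, hU, hUo, hpU⟩ := eventually_nhds_iff.1 h
  obtain ⟨f, hf, -⟩ := (SmoothBumpFunction.nhds_basis_support (I := 𝓡 (4 * n))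
    (hUo.mem_nhds hpU)).mem_iff.1 (hUo.mem_nhds hpU)
  refine ⟨(f : M → ℝ) • X, ?_, ?_⟩
  · exact fun q ↦ (ContMDiffOn.smul_section_of_tsupport f.contMDiff.contMDiffOn hUo hf
      fun q hq ↦ (hU q hq).contMDiffWithinAt).contMDiffAt
  · filter_upwards [f.eventuallyEq_one] with q hq
    simp [hq]

/-- The value of a covariant derivative depends only on the germ of the field. -/
lemma covDeriv_congr (D : AffineConnection n M) {X Y : ∀ q : M, Tan n q} {p : M}
    (hX : DiffFieldAt X p) (hY : DiffFieldAt Y p) (h : ∀ᶠ q in 𝓝 p, X q = Y q) : D X p = D Y p :=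
  D.isCovariantDerivativeOn.congr_of_eventuallyEq (s := Set.univ) hX hY Filter.univ_mem h

/-- A smooth connection maps fields that are smooth near a point to such fields. -/
lemma SmoothNear.covDeriv [T2Space M] {D : AffineConnection n M}
    (hD : CovariantDerivative.ContMDiffCovariantDerivative D ∞) {X Y : ∀ q : M, Tan n q} {p : M}
    (hX : SmoothNear X p) (hY : SmoothNear Y p) : SmoothNear (fun q ↦ D Y q (X q)) p := by
  obtain ⟨Y', hY', hYY'⟩ := hY.exists_contMDiff
  have h1 := hD.contMDiff.contMDiff (σ := Y') fun q _ ↦ (hY' q).contMDiffWithinAt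
  have h2 : ∀ᶠ q in 𝓝 p, ∀ᶠ r in 𝓝 q, D Y r (X r) = D Y' r (X r) := by
    rw [eventually_eventually_nhds]
    filter_upwards [hY.eventually, eventually_eventually_nhds.2 hYY'] with q hq h
    rw [covDeriv_congr D ((hY' q).mdifferentiableAt (by simp)) hq.diffFieldAt h]
  filter_upwards [h2, hX] with q hq hXq
  have h3 : SmoothFieldAt (fun q ↦ D Y' q (X q)) q :=
    (h1.contMDiffAt Filter.univ_mem).clm_bundle_apply hXq
  refine h3.congr_of_eventuallyEq ?_
  filter_upwards [hq] with r hr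
  rw [hr]

lemma SmoothEndOn.smoothNear {A : ∀ p : M, Tan n p →L[ℝ] Tan n p} {U : Set M}
    (hA : SmoothEndOn A U) (hU : IsOpen U) {p : M} (hp : p ∈ U) {X : ∀ q : M, Tan n q}
    (hX : SmoothNear X p) : SmoothNear (fun q ↦ A q (X q)) p := by
  filter_upwards [hX, hU.mem_nhds hp] with q hq hqU
  exact (hA.contMDiffAt (hU.mem_nhds hqU)).clm_bundle_apply hq

lemma covDeriv_add (D : AffineConnection n M) {X Y : ∀ q : M, Tan n q} {p : M}
    (hX : DiffFieldAt X p) (hY : DiffFieldAt Y p) (x : Tan n p) :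
    D (fun q ↦ X q + Y q) p x = D X p x + D Y p x := by
  exact congr($(D.isCovariantDerivativeOn.add (s := Set.univ) hX hY) x)

lemma covDeriv_smul (D : AffineConnection n M) {f : M → ℝ} {X : ∀ q : M, Tan n q} {p : M}
    (hf : DiffFunAt n f p) (hX : DiffFieldAt X p) (x : Tan n p) :
    D (fun q ↦ f q • X q) p x = f p • D X p x + dirDeriv f p x • X p := by
  exact congr($(D.isCovariantDerivativeOn.leibniz (s := Set.univ) hX hf) x)

lemma covDeriv_sub (D : AffineConnection n M) {X Y : ∀ q : M, Tan n q} {p : M}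
    (hX : DiffFieldAt X p) (hY : DiffFieldAt Y p) (x : Tan n p) :
    D (fun q ↦ X q - Y q) p x = D X p x - D Y p x := by
  have h1 : DiffFieldAt (fun q ↦ X q - Y q) p := mdifferentiableAt_sub_section hX hY
  have h := covDeriv_add D h1 hY x
  simp only [sub_add_cancel] at h
  rw [h, add_sub_cancel_right]

/-- `[X, Y] f = X (Y f) - Y (X f)`: both sides are the coefficients of `Z` in the Jacobi identity
for `X`, `Y`, `f Z`. -/
lemma dirDeriv_mlieBracket {X Y Z : ∀ q : M, Tan n q} {f : M → ℝ} {p : M} (hX : SmoothNear X p)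
    (hY : SmoothNear Y p) (hZ : SmoothNear Z p) (hZp : Z p ≠ 0)
    (hf : ∀ᶠ q in 𝓝 p, ContMDiffAt (𝓡 (4 * n)) 𝓘(ℝ, ℝ) ∞ f q)
    (hXf : DiffFunAt n (fun q ↦ dirDeriv f q (X q)) p)
    (hYf : DiffFunAt n (fun q ↦ dirDeriv f q (Y q)) p) :
    dirDeriv f p (VectorField.mlieBracket (𝓡 (4 * n)) X Y p) =
      dirDeriv (fun q ↦ dirDeriv f q (Y q)) p (X p) -
        dirDeriv (fun q ↦ dirDeriv f q (X q)) p (Y p) := by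
  have : IsManifold (𝓡 (4 * n)) (minSmoothness ℝ 2) M := isManifold_minSmoothness 2
  have : IsManifold (𝓡 (4 * n)) (minSmoothness ℝ 3) M := isManifold_minSmoothness 3
  have hmin : minSmoothness ℝ 2 ≤ (∞ : WithTop ℕ∞) := by simp; exact WithTop.coe_le_coe.2 le_top
  have hfd : DiffFunAt n f p := hf.self_of_nhds.mdifferentiableAt (by simp)
  have hfZ : SmoothFieldAt (f • Z) p := hf.self_of_nhds.smul_section hZ.self_of_nhds
  have hbr (V : ∀ q : M, Tan n q) : ∀ᶠ q in 𝓝 p, VectorField.mlieBracket (𝓡 (4 * n)) V (f • Z) q =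
      ((fun r ↦ dirDeriv f r (V r)) • Z + f • VectorField.mlieBracket (𝓡 (4 * n)) V Z) q := by
    filter_upwards [hf, hZ] with q hq hZq
    exact VectorField.mlieBracket_smul_right (hq.mdifferentiableAt (by simp))
      (hZq.mdifferentiableAt (by simp))
  have hbr2 {V W : ∀ q : M, Tan n q} (hV : SmoothNear V p)
      (hVf : DiffFunAt n (fun q ↦ dirDeriv f q (V q)) p) :
      VectorField.mlieBracket (𝓡 (4 * n)) W
        (VectorField.mlieBracket (𝓡 (4 * n)) V (f • Z)) p =
      dirDeriv (fun q ↦ dirDeriv f q (V q)) p (W p) • Z p +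
      dirDeriv f p (V p) • VectorField.mlieBracket (𝓡 (4 * n)) W Z p +
      dirDeriv f p (W p) • VectorField.mlieBracket (𝓡 (4 * n)) V Z p +
      f p • VectorField.mlieBracket (𝓡 (4 * n)) W (VectorField.mlieBracket (𝓡 (4 * n)) V Z) p := by
    have h1 : DiffFieldAt (VectorField.mlieBracket (𝓡 (4 * n)) V Z) p :=
      (hV.mlieBracket hZ).diffFieldAt
    have h2 : DiffFieldAt ((fun r ↦ dirDeriv f r (V r)) • Z) p :=
      hVf.smul_section hZ.diffFieldAt
    have h3 : DiffFieldAt (f • VectorField.mlieBracket (𝓡 (4 * n)) V Z) p := hfd.smul_section h1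
    rw [Filter.EventuallyEq.mlieBracket_vectorField_eq (Filter.EventuallyEq.refl _ W) (hbr V),
      VectorField.mlieBracket_add_right h2 h3,
      VectorField.mlieBracket_smul_right hVf hZ.diffFieldAt,
      VectorField.mlieBracket_smul_right hfd h1]
    abel
  have hJ := VectorField.leibniz_identity_mlieBracket_apply (I := 𝓡 (4 * n))
    (hX.self_of_nhds.of_le hmin) (hY.self_of_nhds.of_le hmin) (hfZ.of_le hmin)
  have hJ' := VectorField.leibniz_identity_mlieBracket_apply (I := 𝓡 (4 * n))
    (hX.self_of_nhds.of_le hmin) (hY.self_of_nhds.of_le hmin) (hZ.self_of_nhds.of_le hmin)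
  rw [hbr2 hY hYf, hbr2 hX hXf, VectorField.mlieBracket_smul_right hfd hZ.diffFieldAt, hJ'] at hJ
  have h : (dirDeriv f p (VectorField.mlieBracket (𝓡 (4 * n)) X Y p) -
      (dirDeriv (fun q ↦ dirDeriv f q (Y q)) p (X p) -
        dirDeriv (fun q ↦ dirDeriv f q (X q)) p (Y p))) • Z p = 0 := by
    rw [← sub_eq_zero] at hJ
    rw [← neg_eq_zero, ← hJ]
    module
  exact sub_eq_zero.1 ((smul_eq_zero.1 h).resolve_right hZp)

end Fields

/-! ### Curvature of vector fields and of metric connections -/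

section Curvature

variable {n : ℕ} {M : Type u} [TopologicalSpace M] [ChartedSpace (Model n) M]

lemma dirDeriv_congr {f g : M → ℝ} {p : M} (h : f =ᶠ[𝓝 p] g) (x : Tan n p) :
    dirDeriv f p x = dirDeriv g p x := by
  exact DFunLike.congr_fun (h.mfderiv_eq (I := 𝓡 (4 * n)) (I' := 𝓘(ℝ, ℝ))) x

variable [IsManifold (𝓡 (4 * n)) ∞ M]

/-- The curvature `D_{[X,Y]} Z - D_X D_Y Z + D_Y D_X Z` of vector fields at `p`. -/
def fieldCurvature (D : AffineConnection n M) (X Y Z : ∀ q : M, Tan n q) (p : M) : Tan n p :=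
  D Z p (VectorField.mlieBracket (𝓡 (4 * n)) X Y p) - D (fun q ↦ D Z q (Y q)) p (X p)
    + D (fun q ↦ D Z q (X q)) p (Y p)

lemma curvature_eq_fieldCurvature (D : AffineConnection n M) (p : M) (x y z : Tan n p) :
    curvature D p x y z = fieldCurvature D (FiberBundle.extend (Model n) x)
      (FiberBundle.extend (Model n) y) (FiberBundle.extend (Model n) z) p := by
  simp [curvature, fieldCurvature]

lemma fieldCurvature_swap (D : AffineConnection n M) (X Y Z : ∀ q : M, Tan n q) (p : M) :
    fieldCurvature D X Y Z p = - fieldCurvature D Y X Z p := by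
  rw [fieldCurvature, fieldCurvature, VectorField.mlieBracket_swap_apply, map_neg]
  abel

/-- The first Bianchi identity for a torsion-free connection follows from the Jacobi identity. -/
lemma fieldCurvature_bianchi [T2Space M] {D : AffineConnection n M}
    (hD : CovariantDerivative.ContMDiffCovariantDerivative D ∞) (ht : D.torsion = 0)
    {X Y Z : ∀ q : M, Tan n q} {p : M} (hX : SmoothNear X p) (hY : SmoothNear Y p)
    (hZ : SmoothNear Z p) :
    fieldCurvature D X Y Z p + fieldCurvature D Y Z X p + fieldCurvature D Z X Y p = 0 := by
  have : IsManifold (𝓡 (4 * n)) (minSmoothness ℝ 2) M := isManifold_minSmoothness 2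
  have : IsManifold (𝓡 (4 * n)) (minSmoothness ℝ 3) M := isManifold_minSmoothness 3
  have ht' {X Y : ∀ q : M, Tan n q} {q : M} (hX : DiffFieldAt X q) (hY : DiffFieldAt Y q) :
      D Y q (X q) - D X q (Y q) = VectorField.mlieBracket (𝓡 (4 * n)) X Y q :=
    D.torsion_eq_zero_iff.1 ht hX hY
  -- `D_X (D_Y Z - D_Z Y) = D_X [Y, Z] = [X, [Y, Z]] + D_{[Y, Z]} X`
  have key {X Y Z : ∀ q : M, Tan n q} (hX : SmoothNear X p) (hY : SmoothNear Y p)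
      (hZ : SmoothNear Z p) : D (fun q ↦ D Z q (Y q)) p (X p) - D (fun q ↦ D Y q (Z q)) p (X p) =
        VectorField.mlieBracket (𝓡 (4 * n)) X (VectorField.mlieBracket (𝓡 (4 * n)) Y Z) p +
        D X p (VectorField.mlieBracket (𝓡 (4 * n)) Y Z p) := by
    have hYZ := SmoothNear.covDeriv hD hY hZ
    have hZY := SmoothNear.covDeriv hD hZ hY
    have hb := hY.mlieBracket hZ
    have h1 : DiffFieldAt (fun q ↦ D Z q (Y q) - D Y q (Z q)) p :=
      mdifferentiableAt_sub_section hYZ.diffFieldAt hZY.diffFieldAt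
    rw [← covDeriv_sub D hYZ.diffFieldAt hZY.diffFieldAt,
      covDeriv_congr D h1 hb.diffFieldAt ?_, ← ht' hX.diffFieldAt hb.diffFieldAt]
    · abel
    · filter_upwards [hY.eventually, hZ.eventually] with q hq hq'
      exact ht' hq.diffFieldAt hq'.diffFieldAt
  have h1 := key hX hY hZ
  have h2 := key hY hZ hX
  have h3 := key hZ hX hY
  have hmin : minSmoothness ℝ 2 ≤ (∞ : WithTop ℕ∞) := by simp; exact WithTop.coe_le_coe.2 le_top
  have hJ := VectorField.leibniz_identity_mlieBracket_apply (I := 𝓡 (4 * n))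
    (hX.self_of_nhds.of_le hmin) (hY.self_of_nhds.of_le hmin) (hZ.self_of_nhds.of_le hmin)
  have h4 : VectorField.mlieBracket (𝓡 (4 * n)) Y (VectorField.mlieBracket (𝓡 (4 * n)) X Z) p =
      - VectorField.mlieBracket (𝓡 (4 * n)) Y (VectorField.mlieBracket (𝓡 (4 * n)) Z X) p := by
    rw [VectorField.mlieBracket_swap (V := X), ← neg_one_smul ℝ,
      VectorField.mlieBracket_const_smul_right (hZ.mlieBracket hX).diffFieldAt, neg_one_smul]
  rw [VectorField.mlieBracket_swap_apply (V := VectorField.mlieBracket (𝓡 (4 * n)) X Y), h4] at hJ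
  simp only [fieldCurvature]
  have e : ∀ a b c a1 a2 b1 b2 c1 c2 u v w : Tan n p, a1 - a2 = u + a → b1 - b2 = v + b →
      c1 - c2 = w + c → u = -w + -v → c - a1 + b2 + (a - b1 + c2) + (b - c1 + a2) = 0 := by
    intro a b c a1 a2 b1 b2 c1 c2 u v w ha hb hc hu
    rw [← neg_eq_zero]
    calc _ = (a1 - a2) + (b1 - b2) + (c1 - c2) - a - b - c := by abel
      _ = _ := by rw [ha, hb, hc, hu]; abel
  exact e _ _ _ _ _ _ _ _ _ _ _ _ h1 h2 h3 hJ

/-- The pair symmetry of a curvature tensor is a consequence of the other symmetries. -/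
lemma pair_symmetry {ι : Type*} {a : ι → ι → ι → ι → ℝ} (h1 : ∀ i j k l, a i j k l = - a j i k l)
    (h2 : ∀ i j k l, a i j k l = - a i j l k)
    (h3 : ∀ i j k l, a i j k l + a j k i l + a k i j l = 0) (i j k l : ι) :
    a i j k l = a k l i j := by
  linarith [h3 i j k l, h3 j k l i, h3 k l i j, h3 l i j k, h1 i j k l, h1 j k i l, h1 k i j l,
    h1 k l j i, h1 l j k i, h1 l i k j, h1 i k l j, h1 i j l k, h1 j l i k, h2 i j k l, h2 j k i l,
    h2 k i j l, h2 j k l i, h2 k l j i, h2 l j k i, h2 k l i j, h2 l i k j, h2 i k l j, h2 l i j k,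
    h2 i j l k, h2 j l i k]

variable [RiemannianBundle (fun p : M ↦ Tan n p)]
  [IsContMDiffRiemannianBundle (𝓡 (4 * n)) ∞ (Model n) (fun p : M ↦ Tan n p)]

lemma SmoothNear.contMDiffAt_inner {X Y : ∀ q : M, Tan n q} {p : M} (hX : SmoothNear X p)
    (hY : SmoothNear Y p) :
    ∀ᶠ q in 𝓝 p, ContMDiffAt (𝓡 (4 * n)) 𝓘(ℝ, ℝ) ∞ (fun q ↦ inner ℝ (X q) (Y q)) q := by
  filter_upwards [hX, hY] with q hq hq'
  exact ContMDiffAt.inner_bundle hq hq'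

lemma SmoothNear.diffFunAt_inner {X Y : ∀ q : M, Tan n q} {p : M} (hX : SmoothNear X p)
    (hY : SmoothNear Y p) : DiffFunAt n (fun q ↦ inner ℝ (X q) (Y q)) p :=
  (hX.contMDiffAt_inner hY).self_of_nhds.mdifferentiableAt (by simp)

lemma dirDeriv_inner {D : AffineConnection n M} (hD : D.IsMetricCompatible)
    {X Y : ∀ q : M, Tan n q} {p : M} (hX : DiffFieldAt X p) (hY : DiffFieldAt Y p) (x : Tan n p) :
    dirDeriv (fun q ↦ inner ℝ (X q) (Y q)) p x =
      inner ℝ (D X p x) (Y p) + inner ℝ (X p) (D Y p x) := by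
  have h := hD.mvfderiv_inner_eq (FiberBundle.extend (Model n) x) hX hY
  simpa using h

variable [T2Space M]

/-- The second derivative of `⟪Z, W⟫` along `Y` and `x`. -/
lemma dirDeriv_dirDeriv_inner {D : AffineConnection n M}
    (hD : CovariantDerivative.ContMDiffCovariantDerivative D ∞) (hm : D.IsMetricCompatible)
    {Y Z W : ∀ q : M, Tan n q} {p : M} (hY : SmoothNear Y p)
    (hZ : SmoothNear Z p) (hW : SmoothNear W p) :
    DiffFunAt n (fun q ↦ dirDeriv (fun r ↦ inner ℝ (Z r) (W r)) q (Y q)) p ∧ ∀ x : Tan n p,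
    dirDeriv (fun q ↦ dirDeriv (fun r ↦ inner ℝ (Z r) (W r)) q (Y q)) p x =
      inner ℝ (D (fun q ↦ D Z q (Y q)) p x) (W p) + inner ℝ (D Z p (Y p)) (D W p x)
      + (inner ℝ (D Z p x) (D W p (Y p)) + inner ℝ (Z p) (D (fun q ↦ D W q (Y q)) p x)) := by
  have h1 : (fun q ↦ dirDeriv (fun r ↦ inner ℝ (Z r) (W r)) q (Y q)) =ᶠ[𝓝 p]
      fun q ↦ inner ℝ (D Z q (Y q)) (W q) + inner ℝ (Z q) (D W q (Y q)) := by
    filter_upwards [hZ.eventually, hW.eventually] with q hq hq'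
    exact dirDeriv_inner hm hq.diffFieldAt hq'.diffFieldAt _
  have hDZ := SmoothNear.covDeriv hD hY hZ
  have hDW := SmoothNear.covDeriv hD hY hW
  refine ⟨?_, fun x ↦ ?_⟩
  · exact ((hDZ.diffFunAt_inner hW).add (hZ.diffFunAt_inner hDW)).congr_of_eventuallyEq h1
  · rw [dirDeriv_congr h1, dirDeriv, mvfderiv_fun_add (hDZ.diffFunAt_inner hW)
      (hZ.diffFunAt_inner hDW), add_apply,
      ← dirDeriv_inner hm hDZ.diffFieldAt hW.diffFieldAt,
      ← dirDeriv_inner hm hZ.diffFieldAt hDW.diffFieldAt]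

/-- The curvature of a metric connection is skew: differentiate `⟪Z, W⟫` twice. -/
lemma inner_fieldCurvature {D : AffineConnection n M}
    (hD : CovariantDerivative.ContMDiffCovariantDerivative D ∞) (hm : D.IsMetricCompatible)
    {X Y Z W : ∀ q : M, Tan n q} {p : M} (hX : SmoothNear X p) (hY : SmoothNear Y p)
    (hZ : SmoothNear Z p) (hW : SmoothNear W p) :
    inner ℝ (fieldCurvature D X Y Z p) (W p) = - inner ℝ (Z p) (fieldCurvature D X Y W p) := by
  -- a field that does not vanish at `p` is needed for `dirDeriv_mlieBracket`
  by_cases h0 : Z p = 0 ∧ W p = 0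
  · rw [h0.1, h0.2, inner_zero_left, inner_zero_right, neg_zero]
  obtain ⟨T, hT, hTp⟩ : ∃ T : ∀ q : M, Tan n q, SmoothNear T p ∧ T p ≠ 0 := by
    by_cases h : Z p = 0
    · exact ⟨W, hW, fun h' ↦ h0 ⟨h, h'⟩⟩
    · exact ⟨Z, hZ, h⟩
  obtain ⟨dX, eX⟩ := dirDeriv_dirDeriv_inner hD hm hX hZ hW
  obtain ⟨dY, eY⟩ := dirDeriv_dirDeriv_inner hD hm hY hZ hW
  have h := dirDeriv_mlieBracket hX hY hT hTp (hZ.contMDiffAt_inner hW) dX dY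
  rw [eX, eY, dirDeriv_inner hm hZ.diffFieldAt hW.diffFieldAt] at h
  simp only [fieldCurvature, inner_add_left, inner_sub_left, inner_add_right, inner_sub_right]
  linear_combination h

/-- The case of `inner_fieldCurvature` in which `W` is the standard extension of `w`. -/
lemma inner_fieldCurvature_extend {D : AffineConnection n M}
    (hD : CovariantDerivative.ContMDiffCovariantDerivative D ∞) (hm : D.IsMetricCompatible)
    {X Y Z : ∀ q : M, Tan n q} {p : M} (hX : SmoothNear X p) (hY : SmoothNear Y p)
    (hZ : SmoothNear Z p) (w : Tan n p) :
    inner ℝ (fieldCurvature D X Y Z p) w =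
      - inner ℝ (Z p) (fieldCurvature D X Y (FiberBundle.extend (Model n) w) p) := by
  simpa using inner_fieldCurvature hD hm hX hY hZ (smoothNear_extend w)

/-- The curvature of a metric connection is tensorial in its third argument, as a consequence of
its skewness. -/
lemma fieldCurvature_congr {D : AffineConnection n M}
    (hD : CovariantDerivative.ContMDiffCovariantDerivative D ∞) (hm : D.IsMetricCompatible)
    {X Y Z Z' : ∀ q : M, Tan n q} {p : M} (hX : SmoothNear X p) (hY : SmoothNear Y p)
    (hZ : SmoothNear Z p) (hZ' : SmoothNear Z' p) (h : Z p = Z' p) :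
    fieldCurvature D X Y Z p = fieldCurvature D X Y Z' p := by
  refine ext_inner_right ℝ fun w ↦ ?_
  rw [inner_fieldCurvature_extend hD hm hX hY hZ, inner_fieldCurvature_extend hD hm hX hY hZ', h]

/-- The curvature operator `z ↦ R_{x,y} z` of a smooth metric connection. -/
def curvatureOperator (D : AffineConnection n M)
    (hD : CovariantDerivative.ContMDiffCovariantDerivative D ∞) (hm : D.IsMetricCompatible)
    (p : M) (x y : Tan n p) : Tan n p →ₗ[ℝ] Tan n p where
  toFun := curvature D p x y
  map_add' z z' := by
    simp only [curvature_eq_fieldCurvature]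
    refine ext_inner_right ℝ fun w ↦ ?_
    rw [inner_add_left]
    simp only [inner_fieldCurvature_extend hD hm (smoothNear_extend x) (smoothNear_extend y)
      (smoothNear_extend _), FiberBundle.extend_apply_self, inner_add_left]
    ring
  map_smul' c z := by
    simp only [curvature_eq_fieldCurvature, RingHom.id_apply]
    refine ext_inner_right ℝ fun w ↦ ?_
    rw [inner_smul_left]
    simp only [inner_fieldCurvature_extend hD hm (smoothNear_extend x) (smoothNear_extend y)
      (smoothNear_extend _), FiberBundle.extend_apply_self, inner_smul_left,
      RCLike.conj_to_real]
    ring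

/-- The curvature at `p` may be computed with any smooth extension of its third argument. -/
lemma curvature_apply_eq {D : AffineConnection n M}
    (hD : CovariantDerivative.ContMDiffCovariantDerivative D ∞) (hm : D.IsMetricCompatible)
    {p : M} (x y : Tan n p) {Z : ∀ q : M, Tan n q} (hZ : SmoothNear Z p) :
    curvature D p x y (Z p) = fieldCurvature D (FiberBundle.extend (Model n) x)
      (FiberBundle.extend (Model n) y) Z p := by
  rw [curvature_eq_fieldCurvature]
  exact fieldCurvature_congr hD hm (smoothNear_extend x) (smoothNear_extend y)
    (smoothNear_extend _) hZ (by simp)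

/-- The curvature of the Levi-Civita connection is an algebraic curvature tensor. -/
lemma curvatureComp_mem_curvatureTensors {D : AffineConnection n M} (hD : IsLeviCivita D) {p : M}
    (e : OrthonormalBasis (QIdx n) ℝ (Tan n p)) : curvatureComp D e ∈ curvatureTensors n := by
  have h1 (i j k l : QIdx n) :
      curvatureComp D e (i, j, k, l) = - curvatureComp D e (j, i, k, l) := by
    simp only [curvatureComp, curvature_eq_fieldCurvature]
    rw [fieldCurvature_swap, inner_neg_left]
  have h2 (i j k l : QIdx n) :
      curvatureComp D e (i, j, k, l) = - curvatureComp D e (i, j, l, k) := by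
    simp only [curvatureComp, curvature_eq_fieldCurvature]
    rw [inner_fieldCurvature_extend hD.smooth hD.metric (smoothNear_extend _) (smoothNear_extend _)
      (smoothNear_extend _), FiberBundle.extend_apply_self, real_inner_comm]
  have h3 (i j k l : QIdx n) : curvatureComp D e (i, j, k, l) + curvatureComp D e (j, k, i, l)
      + curvatureComp D e (k, i, j, l) = 0 := by
    simp only [curvatureComp, curvature_eq_fieldCurvature]
    rw [← inner_add_left, ← inner_add_left, fieldCurvature_bianchi hD.smooth hD.torsion_eq_zero
      (smoothNear_extend _) (smoothNear_extend _) (smoothNear_extend _), inner_zero_left]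
  exact fun i j k l ↦ ⟨h1 i j k l, h2 i j k l,
    pair_symmetry (a := fun i j k l ↦ curvatureComp D e (i, j, k, l)) h1 h2 h3 i j k l, h3 i j k l⟩

end Curvature

/-! ### Curvature of connections preserving the quaternionic structure -/

section Preserving

variable {n : ℕ} {M : Type u} [TopologicalSpace M] [ChartedSpace (Model n) M]
  [IsManifold (𝓡 (4 * n)) ∞ M] [RiemannianBundle (fun p : M ↦ Tan n p)]

section Adapted

variable {V : Type*} [NormedAddCommGroup V] [InnerProductSpace ℝ V]

lemma inner_apply_eq_neg_of_isometry {A : V →L[ℝ] V} (h2 : ∀ x, A (A x) = - x)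
    (h : ∀ x y, inner ℝ (A x) (A y) = inner ℝ x y) (x y : V) :
    inner ℝ (A x) y = - inner ℝ x (A y) := by
  rw [← h x (A y), h2, inner_neg_right, neg_neg]

/-- Adapted bases may be permuted cyclically. -/
lemma IsAdaptedBasis.rotate {G : Submodule ℝ (V →L[ℝ] V)} {I J K : V →L[ℝ] V}
    (h : IsAdaptedBasis G I J K) : IsAdaptedBasis G J K I where
  I_sq := h.J_sq
  J_sq x := by rw [h.JI, h.IJ, h.I_sq, map_neg, h.J_sq, neg_neg]
  IJ x := by rw [h.IJ, ← neg_neg (J (I (J x))), ← h.JI, h.IJ, h.J_sq, map_neg, neg_neg]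
  JI x := by rw [h.IJ, h.J_sq, map_neg, neg_neg]
  inner_I := h.inner_J
  inner_J := h.inner_K
  inner_K := h.inner_I
  span_eq := by rw [h.span_eq, Set.insert_comm I J, Set.pair_comm I K]

lemma IsAdaptedBasis.inner_J_K {G : Submodule ℝ (V →L[ℝ] V)} {I J K : V →L[ℝ] V}
    (h : IsAdaptedBasis G I J K) (x : V) : inner ℝ (J x) (K x) = 0 := by
  have h1 := inner_apply_eq_neg_of_isometry h.I_sq h.inner_I (J x) (J x)
  rw [real_inner_comm, ← h.IJ] at h1
  linarith

end Adapted

/-- Adapted bases of an almost quaternion-Hermitian structure may be permuted cyclically. -/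
lemma IsLocalAdaptedBasis.rotate {G : ∀ p : M, Submodule ℝ (Tan n p →L[ℝ] Tan n p)} {U : Set M}
    {I J K : ∀ p : M, Tan n p →L[ℝ] Tan n p} (h : IsLocalAdaptedBasis G U I J K) :
    IsLocalAdaptedBasis G U J K I where
  isOpen := h.isOpen
  smooth_I := h.smooth_J
  smooth_J := h.smooth_K
  smooth_K := h.smooth_I
  adapted p hp := (h.adapted p hp).rotate

variable [IsContMDiffRiemannianBundle (𝓡 (4 * n)) ∞ (Model n) (fun p : M ↦ Tan n p)]

/-- For a metric connection, the covariant derivative `D_x(AZ) - A(D_x Z)` of a skew endomorphism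
field is skew. -/
lemma inner_covDeriv_apply_sub {D : AffineConnection n M} (hm : D.IsMetricCompatible)
    {A : ∀ p : M, Tan n p →L[ℝ] Tan n p} {U : Set M} (hA : SmoothEndOn A U) (hU : IsOpen U)
    (hskew : ∀ q ∈ U, ∀ x y, inner ℝ (A q x) y = - inner ℝ x (A q y))
    {p : M} (hp : p ∈ U) {Z W : ∀ q : M, Tan n q} (hZ : SmoothNear Z p) (hW : SmoothNear W p)
    (x : Tan n p) :
    inner ℝ (D (fun q ↦ A q (Z q)) p x - A p (D Z p x)) (W p) =
      - inner ℝ (Z p) (D (fun q ↦ A q (W q)) p x - A p (D W p x)) := by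
  have hAZ := hA.smoothNear hU hp hZ
  have hAW := hA.smoothNear hU hp hW
  have h1 := dirDeriv_inner hm hAZ.diffFieldAt hW.diffFieldAt x
  have h2 := dirDeriv_inner hm hZ.diffFieldAt hAW.diffFieldAt x
  have h3 : (fun q ↦ inner ℝ (A q (Z q)) (W q)) =ᶠ[𝓝 p] - fun q ↦ inner ℝ (Z q) (A q (W q)) := by
    filter_upwards [hU.mem_nhds hp] with q hq
    exact hskew q hq _ _
  rw [dirDeriv_congr h3, dirDeriv, mvfderiv_neg, neg_apply] at h1
  rw [hskew p hp] at h1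
  rw [inner_sub_left, inner_sub_right, hskew p hp]
  simp only [dirDeriv] at h2
  linarith

/-- The covariant derivative of a skew endomorphism field may be computed with any smooth
extension of its argument. -/
lemma covDerivEnd_eq {D : AffineConnection n M} (hm : D.IsMetricCompatible)
    {A : ∀ p : M, Tan n p →L[ℝ] Tan n p} {U : Set M} (hA : SmoothEndOn A U) (hU : IsOpen U)
    (hskew : ∀ q ∈ U, ∀ x y, inner ℝ (A q x) y = - inner ℝ x (A q y))
    {p : M} (hp : p ∈ U) {Z : ∀ q : M, Tan n q} (hZ : SmoothNear Z p) (x : Tan n p) :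
    covDerivEnd D A p x (Z p) = D (fun q ↦ A q (Z q)) p x - A p (D Z p x) := by
  refine ext_inner_right ℝ fun w ↦ ?_
  have h1 := inner_covDeriv_apply_sub hm hA hU hskew hp hZ (smoothNear_extend w) x
  have h2 := inner_covDeriv_apply_sub hm hA hU hskew hp (smoothNear_extend (Z p))
    (smoothNear_extend w) x
  rw [FiberBundle.extend_apply_self] at h1 h2
  rw [h1, covDerivEnd, h2, FiberBundle.extend_apply_self]

/-- A smooth metric connection `D` preserves the span of the local adapted basis `A, B, C` of `G`
on `U`, with connection forms `f`, `g`, `h`: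
`D A = f B - g C`, `D B = h C - f A`, `D C = g A - h B`. -/
structure PreservesBasis (D : AffineConnection n M)
    (G : ∀ p : M, Submodule ℝ (Tan n p →L[ℝ] Tan n p)) (U : Set M)
    (A B C : ∀ p : M, Tan n p →L[ℝ] Tan n p) (f g h : ∀ q : M, Tan n q →L[ℝ] ℝ) : Prop where
  smooth : CovariantDerivative.ContMDiffCovariantDerivative D ∞
  metric : D.IsMetricCompatible
  basis : IsLocalAdaptedBasis G U A B C
  deriv_A : ∀ q ∈ U, ∀ x y, covDerivEnd D A q x y = f q x • B q y - g q x • C q y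
  deriv_B : ∀ q ∈ U, ∀ x y, covDerivEnd D B q x y = h q x • C q y - f q x • A q y
  deriv_C : ∀ q ∈ U, ∀ x y, covDerivEnd D C q x y = g q x • A q y - h q x • B q y

variable {D : AffineConnection n M} {G : ∀ p : M, Submodule ℝ (Tan n p →L[ℝ] Tan n p)} {U : Set M}
    {A B C : ∀ p : M, Tan n p →L[ℝ] Tan n p} {f g h : ∀ q : M, Tan n q →L[ℝ] ℝ}

lemma PreservesBasis.rotate (H : PreservesBasis D G U A B C f g h) :
    PreservesBasis D G U B C A h f g :=
  ⟨H.smooth, H.metric, H.basis.rotate, H.deriv_B, H.deriv_C, H.deriv_A⟩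

/-- The Leibniz rule `D_x (A Z) = A (D_x Z) + (D_x A) Z` for any smooth field `Z`. -/
lemma PreservesBasis.covDeriv_A (H : PreservesBasis D G U A B C f g h) {p : M} (hp : p ∈ U)
    {Z : ∀ q : M, Tan n q} (hZ : SmoothNear Z p) (x : Tan n p) :
    D (fun q ↦ A q (Z q)) p x = A p (D Z p x) + (f p x • B p (Z p) - g p x • C p (Z p)) := by
  rw [← H.deriv_A p hp, covDerivEnd_eq H.metric H.basis.smooth_I H.basis.isOpen
    (fun q hq ↦ inner_apply_eq_neg_of_isometry (H.basis.adapted q hq).I_sq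
      (H.basis.adapted q hq).inner_I) hp hZ]
  abel

variable [T2Space M]

/-- The connection forms are differentiable along smooth vector fields, since
`f(Y) |Z|² = ⟪(D_Y A) Z, B Z⟫`. -/
lemma PreservesBasis.diffFunAt (H : PreservesBasis D G U A B C f g h) {p : M} (hp : p ∈ U)
    {z : Tan n p} (hz : z ≠ 0) {Y : ∀ q : M, Tan n q} (hY : SmoothNear Y p) :
    DiffFunAt n (fun q ↦ f q (Y q)) p ∧ DiffFunAt n (fun q ↦ g q (Y q)) p := by
  obtain ⟨Z, hZ, hZp⟩ : ∃ Z : ∀ q : M, Tan n q, SmoothNear Z p ∧ Z p = z :=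
    ⟨_, smoothNear_extend z, FiberBundle.extend_apply_self _ z⟩
  have hU := H.basis.isOpen
  have hZZ := hZ.contMDiffAt_inner hZ
  have hpos : ∀ᶠ q in 𝓝 p, inner ℝ (Z q) (Z q) ≠ (0 : ℝ) := by
    refine (hZZ.self_of_nhds.continuousAt).eventually_ne ?_
    rw [hZp]
    exact inner_self_ne_zero.2 hz
  have hA := H.basis.smooth_I.smoothNear hU hp hZ
  have hB := H.basis.smooth_J.smoothNear hU hp hZ
  have hC := H.basis.smooth_K.smoothNear hU hp hZ
  have hDA := SmoothNear.covDeriv H.smooth hY hA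
  have hDZ := H.basis.smooth_I.smoothNear hU hp (SmoothNear.covDeriv H.smooth hY hZ)
  have key (T : ∀ q : M, Tan n q) (hT : SmoothNear T p) (φ : M → ℝ)
      (hφ : ∀ᶠ q in 𝓝 p, inner ℝ (D (fun q ↦ A q (Z q)) q (Y q)) (T q)
        - inner ℝ (A q (D Z q (Y q))) (T q) = φ q * inner ℝ (Z q) (Z q)) : DiffFunAt n φ p := by
    have h1 : ContMDiffAt (𝓡 (4 * n)) 𝓘(ℝ, ℝ) ∞ (fun q ↦
        (inner ℝ (D (fun q ↦ A q (Z q)) q (Y q)) (T q)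
        - inner ℝ (A q (D Z q (Y q))) (T q)) / inner ℝ (Z q) (Z q)) p :=
      ((hDA.contMDiffAt_inner hT).self_of_nhds.sub (hDZ.contMDiffAt_inner hT).self_of_nhds).div₀
        hZZ.self_of_nhds hpos.self_of_nhds
    refine (h1.congr_of_eventuallyEq ?_).mdifferentiableAt (by simp)
    filter_upwards [hφ, hpos] with q hq hq'
    rw [hq, mul_div_cancel_right₀ _ hq']
  have hD : ∀ᶠ q in 𝓝 p, D (fun q ↦ A q (Z q)) q (Y q) =
      A q (D Z q (Y q)) + (f q (Y q) • B q (Z q) - g q (Y q) • C q (Z q)) := by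
    filter_upwards [hZ.eventually, hU.mem_nhds hp] with q hq hqU
    exact H.covDeriv_A hqU hq _
  constructor
  · refine key _ hB _ ?_
    filter_upwards [hD, hU.mem_nhds hp] with q hq hqU
    have ha := H.basis.adapted q hqU
    rw [hq, inner_add_left, inner_sub_left, inner_smul_left, inner_smul_left, ha.inner_J,
      real_inner_comm (B q (Z q)) (C q (Z q)), ha.inner_J_K]
    simp
  -- pairing with `-C Z` instead of `B Z` extracts `g(Y)`, which occurs with a minus sign
  · have hC' : SmoothNear (fun q ↦ (-1 : ℝ) • C q (Z q)) p := by
      filter_upwards [hC] with q hq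
      exact hq.const_smul_section
    refine key _ hC' _ ?_
    filter_upwards [hD, hU.mem_nhds hp] with q hq hqU
    have ha := H.basis.adapted q hqU
    rw [hq, inner_add_left, inner_sub_left, inner_smul_left, inner_smul_left, inner_smul_right,
      inner_smul_right, inner_smul_right, ha.inner_K, ha.inner_J_K]
    simp

/-- The second derivative `D_x D_Y (A Z)`, from the Leibniz rule for
`D_Y (A Z) = A (D_Y Z) + f(Y) B Z - g(Y) C Z`. -/
lemma PreservesBasis.covDeriv_covDeriv_A (H : PreservesBasis D G U A B C f g h) {p : M}
    (hp : p ∈ U) {z : Tan n p} (hz : z ≠ 0) {Y Z : ∀ q : M, Tan n q}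
    (hY : SmoothNear Y p) (hZ : SmoothNear Z p) (x : Tan n p) :
    D (fun q ↦ D (fun r ↦ A r (Z r)) q (Y q)) p x =
      A p (D (fun q ↦ D Z q (Y q)) p x)
      + (f p x • B p (D Z p (Y p)) - g p x • C p (D Z p (Y p)))
      + (f p (Y p) • (B p (D Z p x) + (h p x • C p (Z p) - f p x • A p (Z p)))
        + dirDeriv (fun q ↦ f q (Y q)) p x • B p (Z p))
      - (g p (Y p) • (C p (D Z p x) + (g p x • A p (Z p) - h p x • B p (Z p)))
        + dirDeriv (fun q ↦ g q (Y q)) p x • C p (Z p)) := by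
  have hU := H.basis.isOpen
  have hA := H.basis.smooth_I.smoothNear hU hp hZ
  have hB := H.basis.smooth_J.smoothNear hU hp hZ
  have hC := H.basis.smooth_K.smoothNear hU hp hZ
  have hDZ := SmoothNear.covDeriv H.smooth hY hZ
  have hADZ := H.basis.smooth_I.smoothNear hU hp hDZ
  obtain ⟨hf, hg⟩ := H.diffFunAt hp hz hY
  have hfB : DiffFieldAt (fun q ↦ f q (Y q) • B q (Z q)) p := hf.smul_section hB.diffFieldAt
  have hgC : DiffFieldAt (fun q ↦ g q (Y q) • C q (Z q)) p := hg.smul_section hC.diffFieldAt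
  have hsum : DiffFieldAt (fun q ↦ A q (D Z q (Y q)) + f q (Y q) • B q (Z q)) p :=
    mdifferentiableAt_add_section hADZ.diffFieldAt hfB
  have htot : DiffFieldAt
      (fun q ↦ A q (D Z q (Y q)) + f q (Y q) • B q (Z q) - g q (Y q) • C q (Z q)) p :=
    mdifferentiableAt_sub_section hsum hgC
  rw [covDeriv_congr D (SmoothNear.covDeriv H.smooth hY hA).diffFieldAt htot ?_,
    covDeriv_sub D hsum hgC, covDeriv_add D hADZ.diffFieldAt hfB,
    covDeriv_smul D hf hB.diffFieldAt, covDeriv_smul D hg hC.diffFieldAt,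
    H.covDeriv_A hp hDZ, H.rotate.covDeriv_A hp hZ, H.rotate.rotate.covDeriv_A hp hZ]
  filter_upwards [hZ.eventually, hU.mem_nhds hp] with q hq hqU
  rw [H.covDeriv_A hqU hq, add_sub_assoc]

/-- The curvature operators of `D` map `A` into the span of `B` and `C`: the coefficients are those
of the curvature of the connection induced on `G`. -/
lemma PreservesBasis.exists_commutator (H : PreservesBasis D G U A B C f g h) {p : M}
    (hp : p ∈ U) {z : Tan n p} (hz : z ≠ 0) {X Y : ∀ q : M, Tan n q}
    (hX : SmoothNear X p) (hY : SmoothNear Y p) :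
    ∃ α β : ℝ, ∀ Z : ∀ q : M, Tan n q, SmoothNear Z p →
      fieldCurvature D X Y (fun q ↦ A q (Z q)) p - A p (fieldCurvature D X Y Z p) =
        α • B p (Z p) + β • C p (Z p) := by
  refine ⟨f p (VectorField.mlieBracket (𝓡 (4 * n)) X Y p)
      - dirDeriv (fun q ↦ f q (Y q)) p (X p) + dirDeriv (fun q ↦ f q (X q)) p (Y p)
      - g p (Y p) * h p (X p) + g p (X p) * h p (Y p),
    - g p (VectorField.mlieBracket (𝓡 (4 * n)) X Y p)
      + dirDeriv (fun q ↦ g q (Y q)) p (X p) - dirDeriv (fun q ↦ g q (X q)) p (Y p)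
      - f p (Y p) * h p (X p) + f p (X p) * h p (Y p), fun Z hZ ↦ ?_⟩
  rw [fieldCurvature, fieldCurvature, H.covDeriv_covDeriv_A hp hz hY hZ,
    H.covDeriv_covDeriv_A hp hz hX hZ, H.covDeriv_A hp hZ, map_add, map_sub]
  module

/-- The curvature operators of `D` map `A` into `G`. -/
lemma PreservesBasis.exists_mem_commutator (H : PreservesBasis D G U A B C f g h) {p : M}
    (hp : p ∈ U) {z : Tan n p} (hz : z ≠ 0) (x y : Tan n p) :
    ∃ E ∈ G p, ∀ v, curvatureOperator D H.smooth H.metric p x y (A p v)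
      - A p (curvatureOperator D H.smooth H.metric p x y v) = E v := by
  obtain ⟨α, β, hαβ⟩ := H.exists_commutator hp hz (smoothNear_extend x) (smoothNear_extend y)
  have hG := (H.basis.adapted p hp).span_eq
  refine ⟨α • B p + β • C p, ?_, fun v ↦ ?_⟩
  · rw [hG]
    exact add_mem (Submodule.smul_mem _ _ (Submodule.subset_span (by simp)))
      (Submodule.smul_mem _ _ (Submodule.subset_span (by simp)))
  · have hv := smoothNear_extend v
    have h1 := hαβ _ hv
    rw [← curvature_apply_eq H.smooth H.metric x y hv,
      ← curvature_apply_eq H.smooth H.metric x y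
        (H.basis.smooth_I.smoothNear H.basis.isOpen hp hv), FiberBundle.extend_apply_self] at h1
    exact h1

/-- The curvature operators of an `Sp(n)Sp(1)`-connection normalise `G`. -/
lemma IsSpnSp1Connection.exists_mem_commutator {Q : AlmostQuaternionHermitian n M}
    (hD : IsSpnSp1Connection Q D) {p : M} {z : Tan n p} (hz : z ≠ 0) (x y : Tan n p) :
    ∀ A ∈ Q.G p, ∃ C ∈ Q.G p, ∀ v, curvatureOperator D hD.smooth hD.metric p x y (A v)
      - A (curvatureOperator D hD.smooth hD.metric p x y v) = C v := by
  obtain ⟨U, hp, I, J, K, hb, lI, lJ, lK, hl⟩ := hD.preserves p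
  have H : PreservesBasis D Q.G U I J K lK lJ lI :=
    ⟨hD.smooth, hD.metric, hb, fun q hq x y ↦ (hl q hq x y).1, fun q hq x y ↦ (hl q hq x y).2.1,
      fun q hq x y ↦ (hl q hq x y).2.2⟩
  intro A hA
  rw [(hb.adapted p hp).span_eq] at hA
  induction hA using Submodule.span_induction with
  | mem A hA =>
    rcases hA with rfl | rfl | rfl
    · exact H.exists_mem_commutator hp hz x y
    · exact H.rotate.exists_mem_commutator hp hz x y
    · exact H.rotate.rotate.exists_mem_commutator hp hz x y
  | zero => exact ⟨0, zero_mem _, fun v ↦ by simp⟩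
  | add A B _ _ hA hB =>
    obtain ⟨C, hC, h⟩ := hA
    obtain ⟨C', hC', h'⟩ := hB
    refine ⟨C + C', add_mem hC hC', fun v ↦ ?_⟩
    rw [add_apply, add_apply, add_apply, map_add, ← h, ← h']
    abel
  | smul c A _ hA =>
    obtain ⟨C, hC, h⟩ := hA
    refine ⟨c • C, Submodule.smul_mem _ _ hC, fun v ↦ ?_⟩
    rw [smul_apply, smul_apply, smul_apply, map_smul, ← h, smul_sub]

/-- The curvature of an `Sp(n)Sp(1)`-connection lies in `Λ² ⊗ (𝔰𝔭(n) ⊕ 𝔰𝔭(1))`, the kernel of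
`π₁`. -/
lemma piOne_curvatureComp_eq_zero (hn : n ≠ 0) {Q : AlmostQuaternionHermitian n M}
    (hD : IsSpnSp1Connection Q D) {p : M} {e : OrthonormalBasis (QIdx n) ℝ (Tan n p)}
    (he : IsAdaptedFrame (Q.G p) e) : piOne n (curvatureComp D e) = 0 := by
  have hz : e (⟨0, Nat.pos_of_ne_zero hn⟩, 0) ≠ 0 := e.orthonormal.ne_zero _
  exact piOne_eq_zero hn fun i j A ↦ frameMatrix_commutator_mem_span he
    (hD.exists_mem_commutator hz (e i) (e j)) A

end Preserving

/-! ### Comparison of the curvatures of two connections -/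

section Comparison

variable {n : ℕ} {M : Type u} [TopologicalSpace M] [ChartedSpace (Model n) M]
  [IsManifold (𝓡 (4 * n)) ∞ M]

lemma diffTensor_apply (D D' : AffineConnection n M) {p : M} (x : Tan n p)
    {Z : ∀ q : M, Tan n q} (hZ : DiffFieldAt Z p) :
    diffTensor D D' p x (Z p) = D' Z p x - D Z p x := by
  have h := IsCovariantDerivativeOn.difference_apply D'.isCovariantDerivativeOnUniv
    D.isCovariantDerivativeOnUniv (x := p) (hx := trivial) hZ
  exact congr($h x)

lemma diffTensor_add (D D' : AffineConnection n M) {p : M} (x y z : Tan n p) :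
    diffTensor D D' p (x + y) z = diffTensor D D' p x z + diffTensor D D' p y z :=
  map_add (CovariantDerivative.difference D' D p z) x y

lemma diffTensor_sub (D D' : AffineConnection n M) {p : M} (x y z : Tan n p) :
    diffTensor D D' p (x - y) z = diffTensor D D' p x z - diffTensor D D' p y z :=
  map_sub (CovariantDerivative.difference D' D p z) x y

lemma diffTensor_smul (D D' : AffineConnection n M) {p : M} (c : ℝ) (x z : Tan n p) :
    diffTensor D D' p (c • x) z = c • diffTensor D D' p x z :=
  map_smul (CovariantDerivative.difference D' D p z) c x

variable [T2Space M]

/-- `D_x D_Y Z` in terms of `D'` and `ξ = D' - D`. -/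
lemma covDeriv_covDeriv_eq {D D' : AffineConnection n M}
    (hD : CovariantDerivative.ContMDiffCovariantDerivative D ∞)
    (hD' : CovariantDerivative.ContMDiffCovariantDerivative D' ∞) {p : M} (x y z : Tan n p) :
    D (fun q ↦ D (FiberBundle.extend (Model n) z) q (FiberBundle.extend (Model n) y q)) p x =
      D' (fun q ↦ D' (FiberBundle.extend (Model n) z) q (FiberBundle.extend (Model n) y q)) p x
      - covDerivDiffTensor D D' p x y z
      - diffTensor D D' p (D' (FiberBundle.extend (Model n) y) p x) z
      - diffTensor D D' p y (D' (FiberBundle.extend (Model n) z) p x)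
      - diffTensor D D' p x (D' (FiberBundle.extend (Model n) z) p y)
      + diffTensor D D' p x (diffTensor D D' p y z) := by
  have hY := smoothNear_extend y
  have hZ := smoothNear_extend z
  have hYp := FiberBundle.extend_apply_self (Model n) y
  have hZp := FiberBundle.extend_apply_self (Model n) z
  rw [covDerivDiffTensor]
  generalize (FiberBundle.extend (Model n) y : ∀ q : M, Tan n q) = Y at *
  generalize (FiberBundle.extend (Model n) z : ∀ q : M, Tan n q) = Z at *
  have hDZ := SmoothNear.covDeriv hD hY hZ
  have hDZ' := SmoothNear.covDeriv hD' hY hZ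
  have hdiff : DiffFieldAt (fun q ↦ D' Z q (Y q) - D Z q (Y q)) p :=
    mdifferentiableAt_sub_section hDZ'.diffFieldAt hDZ.diffFieldAt
  have hev : ∀ᶠ q in 𝓝 p, diffTensor D D' q (Y q) (Z q) = D' Z q (Y q) - D Z q (Y q) := by
    filter_upwards [hZ.eventually] with q hq
    exact diffTensor_apply D D' _ hq.diffFieldAt
  have hξ : DiffFieldAt (fun q ↦ diffTensor D D' q (Y q) (Z q)) p := by
    refine hdiff.congr_of_eventuallyEq ?_
    filter_upwards [hev] with q hq
    rw [hq]
  have h1 : D' (fun q ↦ diffTensor D D' q (Y q) (Z q)) p x =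
      D' (fun q ↦ D' Z q (Y q)) p x - D' (fun q ↦ D Z q (Y q)) p x := by
    rw [covDeriv_congr D' hξ hdiff hev, covDeriv_sub D' hDZ'.diffFieldAt hDZ.diffFieldAt]
  have h2 := diffTensor_apply D D' x hDZ.diffFieldAt
  have h3 := diffTensor_apply D D' y hZ.diffFieldAt
  rw [hYp, show D Z p y = D' Z p y - diffTensor D D' p y z by rw [← hZp, h3, sub_sub_cancel],
    map_sub] at h2
  rw [h1, ← sub_eq_zero]
  rw [← sub_eq_zero] at h2
  rw [← h2]
  abel

/-- The curvature of a torsion-free connection `D` in terms of that of `D'` and of `ξ = D' - D`. -/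
lemma curvature_eq_add {D D' : AffineConnection n M}
    (hD : CovariantDerivative.ContMDiffCovariantDerivative D ∞) (ht : D.torsion = 0)
    (hD' : CovariantDerivative.ContMDiffCovariantDerivative D' ∞) (p : M) (x y z : Tan n p) :
    curvature D p x y z = curvature D' p x y z
      + (covDerivDiffTensor D D' p x y z - covDerivDiffTensor D D' p y x z)
      + diffTensor D D' p (diffTensor D D' p x y - diffTensor D D' p y x) z
      - (diffTensor D D' p x (diffTensor D D' p y z)
        - diffTensor D D' p y (diffTensor D D' p x z)) := by
  have hX := (smoothNear_extend x).diffFieldAt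
  have hY := (smoothNear_extend y).diffFieldAt
  have hZ := (smoothNear_extend z).diffFieldAt
  have h1 := D.torsion_eq_zero_iff.1 ht hX hY
  have h2 := diffTensor_apply D D' x hY
  have h3 := diffTensor_apply D D' y hX
  have h4 := diffTensor_apply D D' (VectorField.mlieBracket (𝓡 (4 * n))
    (FiberBundle.extend (Model n) x) (FiberBundle.extend (Model n) y) p) hZ
  rw [FiberBundle.extend_apply_self] at h2 h3 h4
  rw [FiberBundle.extend_apply_self, FiberBundle.extend_apply_self] at h1
  -- the torsion of `D'`
  have h5 : diffTensor D D' p x y - diffTensor D D' p y x =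
      D' (FiberBundle.extend (Model n) y) p x - D' (FiberBundle.extend (Model n) x) p y
      - VectorField.mlieBracket (𝓡 (4 * n)) (FiberBundle.extend (Model n) x)
        (FiberBundle.extend (Model n) y) p := by
    rw [h2, h3, ← h1]
    abel
  rw [h5, diffTensor_sub, diffTensor_sub, h4, curvature, curvature,
    covDeriv_covDeriv_eq hD hD', covDeriv_covDeriv_eq hD hD']
  abel

end Comparison

/-- The components of `R - R'`, for the curvatures `R` of a torsion-free connection `D` and `R'` of a
connection `D'`, as a linear function of those of `D' ξ` and `ξ ⊗ ξ`, where `ξ = D' - D`. -/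
def curvatureCorrection (n : ℕ) : Tensor4 n × Tensor6 n →ₗ[ℝ] Tensor4 n where
  toFun t := WithLp.toLp 2 fun (i, j, k, l) ↦
    t.1 (i, j, k, l) - t.1 (j, i, k, l)
      + ∑ m, (t.2 (i, j, m, m, k, l) - t.2 (j, i, m, m, k, l))
      - ∑ m, (t.2 (j, k, m, i, m, l) - t.2 (i, k, m, j, m, l))
  map_add' s t := by
    ext i
    simp only [Prod.fst_add, Prod.snd_add, PiLp.add_apply, Finset.sum_sub_distrib,
      Finset.sum_add_distrib]
    ring
  map_smul' c t := by
    ext i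
    simp only [Prod.smul_fst, Prod.smul_snd, PiLp.smul_apply, smul_eq_mul, RingHom.id_apply,
      ← mul_sub, ← mul_add, ← Finset.mul_sum]

section

variable {n : ℕ} {M : Type u} [TopologicalSpace M] [ChartedSpace (Model n) M]
  [IsManifold (𝓡 (4 * n)) ∞ M] [RiemannianBundle (fun p : M ↦ Tan n p)]

lemma inner_diffTensor_diffTensor_left (D D' : AffineConnection n M) {p : M}
    (e : OrthonormalBasis (QIdx n) ℝ (Tan n p)) (i j k l : QIdx n) :
    inner ℝ (diffTensor D D' p (diffTensor D D' p (e i) (e j)) (e k)) (e l) =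
      ∑ m, diffTensorSqComp D D' e (i, j, m, m, k, l) := by
  have h (v : Tan n p) : inner ℝ (diffTensor D D' p v (e k)) (e l) =
      ∑ m, inner ℝ v (e m) * inner ℝ (diffTensor D D' p (e m) (e k)) (e l) := by
    let φ : Tan n p →ₗ[ℝ] ℝ :=
      { toFun v := inner ℝ (diffTensor D D' p v (e k)) (e l)
        map_add' v w := by rw [diffTensor_add, inner_add_left]
        map_smul' c v := by rw [diffTensor_smul, inner_smul_left]; rfl }
    have h := congr_arg φ (e.sum_repr' v)
    rw [map_sum] at h
    simp only [map_smul, smul_eq_mul] at h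
    exact h.symm.trans (Finset.sum_congr rfl fun m _ ↦ by rw [real_inner_comm]; rfl)
  exact h _

lemma inner_diffTensor_diffTensor_right (D D' : AffineConnection n M) {p : M}
    (e : OrthonormalBasis (QIdx n) ℝ (Tan n p)) (i j k l : QIdx n) :
    inner ℝ (diffTensor D D' p (e i) (diffTensor D D' p (e j) (e k))) (e l) =
      ∑ m, diffTensorSqComp D D' e (j, k, m, i, m, l) := by
  conv_lhs => rw [← e.sum_repr' (diffTensor D D' p (e j) (e k))]
  rw [map_sum, sum_inner]
  refine Finset.sum_congr rfl fun m _ ↦ ?_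
  rw [map_smul, inner_smul_left, RCLike.conj_to_real, real_inner_comm]
  rfl

lemma curvatureComp_eq_add [T2Space M] {D D' : AffineConnection n M}
    (hD : CovariantDerivative.ContMDiffCovariantDerivative D ∞) (ht : D.torsion = 0)
    (hD' : CovariantDerivative.ContMDiffCovariantDerivative D' ∞) {p : M}
    (e : OrthonormalBasis (QIdx n) ℝ (Tan n p)) :
    curvatureComp D e = curvatureComp D' e +
      curvatureCorrection n (covDerivDiffComp D D' e, diffTensorSqComp D D' e) := by
  ext ⟨i, j, k, l⟩
  have h := congr_arg (fun v ↦ inner ℝ v (e l)) (curvature_eq_add hD ht hD' p (e i) (e j) (e k))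
  simp only [inner_add_left, inner_sub_left, diffTensor_sub, inner_diffTensor_diffTensor_left,
    inner_diffTensor_diffTensor_right, ← Finset.sum_sub_distrib] at h
  rw [PiLp.add_apply]
  refine h.trans ?_
  simp only [curvatureCorrection, LinearMap.coe_mk, AddHom.coe_mk, curvatureComp, covDerivDiffComp]
  ring

end

end

theorem mainTheorem9 (n : ℕ) (hn : 1 < n) :
    ∃ L : Tensor4 n × Tensor6 n →ₗ[ℝ] QKperp n,
      ∀ (M : Type u) [TopologicalSpace M] [T2Space M] [ChartedSpace (Model n) M]
        [IsManifold (𝓡 (4 * n)) ∞ M] [RiemannianBundle (fun p : M ↦ Tan n p)]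
        [IsContMDiffRiemannianBundle (𝓡 (4 * n)) ∞ (Model n) (fun p : M ↦ Tan n p)]
        (Q : AlmostQuaternionHermitian n M) (D D' : AffineConnection n M),
        IsLeviCivita D → IsMinimalConnection Q D D' →
        ∀ (p : M) (e : OrthonormalBasis (QIdx n) ℝ (Tan n p)), IsAdaptedFrame (Q.G p) e →
          piPerp n (curvatureComp D e) = L (covDerivDiffComp D D' e, diffTensorSqComp D D' e) := by
  obtain ⟨ρ, hρ⟩ := exists_piPerp_eq_comp_piOne n
  refine ⟨ρ ∘ₗ piOne n ∘ₗ curvatureCorrection n, fun M _ _ _ _ _ _ Q D D' hD hD' p e he ↦ ?_⟩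
  rw [hρ _ (curvatureComp_mem_curvatureTensors hD e),
    curvatureComp_eq_add hD.smooth hD.torsion_eq_zero hD'.smooth e, map_add,
    piOne_curvatureComp_eq_zero (by lia) hD'.toIsSpnSp1Connection he, zero_add]
  rfl
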